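/- Let $n,m\ge 0$ be integers, $\mathbf G=SU(2^n)$, and let $X_1,\dots,X_m\in\mathfrak{su}(2^n)$ generate $\mathfrak{su}(2^n)$ as a real Lie algebra. Let $\mathbf V=[-1,1]^m$ and let $\mathcal V$ be the set of piecewise continuous functions $v:[0,\infty)\to\mathbf V$ (finitely many discontinuities on bounded intervals, one-sided limits everywhere). For $v\in\mathcal V$ and $U_0\in\mathbf G$ let $U(\cdot)=U(\cdot\,;v,U_0)$ be the solution in $\mathbf G$ of $$\dot U(t)=f(U(t),v(t)),\qquad U(0)=U_0,\qquad f(U,v)=\Big(\sum_{k=1}^m v_kX_k\Big)U .$$ Let $\mathbf T\subseteq\mathbf G$ be compact with topological boundary $\partial\mathbf T$, and let $t_{U_0}(v)=\inf\{t\ge 0: U(t;v,U_0)\in\partial\mathbf T\}\in[0,\infty]$ (with $\inf\emptyset=\infty$). Let $\ell:\mathbf G\times\mathbf V\to\mathbb R$ be continuous and strictly positive, let $\lambda>0$, and define $$S(U_0)=\inf_{v\in\mathcal V}\int_0^{t_{U_0}(v)}\ell\big(U(s;v,U_0),v(s)\big)\,e^{-\lambda s}\,ds .$$ Put $\Omega=\mathbf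 G\setminus\mathbf T$ and $$F(U,r,\zeta)=\lambda r+H(U,\zeta),\qquad H(U,\zeta)=\sup_{v\in\mathbf V}\{-\zeta\cdot f(U,v)-\ell(U,v)\},\qquad \zeta\in T_U^*\mathbf G .$$ Then $S$ is a continuous viscosity solution of $F(U,S,DS)=0$ in $\Omega$; that is, $S$ is continuous on $\overline\Omega$ and, for every $\phi\in C^1(\Omega)$ and every $U\in\Omega$: (i) if $S-\phi$ has a local maximum at $U$, then $F(U,S(U),D\phi(U))\le 0$; (ii) if $S-\phi$ has a local minimum at $U$, then $F(U,S(U),D\phi(U))\ge 0$. -/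

import Mathlib

open Set Filter Topology MeasureTheory

/- The matrix commutator bracket, and the entrywise sup norm on matrices (its topology is the usual
one; in finite dimension the notions of derivative below do not depend on the norm). -/
attribute [local instance] LieRing.ofAssociativeRing Matrix.normedAddCommGroup Matrix.normedSpace

namespace SpinControl

/-- The special unitary group `SU(N)`, with the topology induced from the complex matrices. -/
abbrev SU (N : ℕ) : Type := ↥(Matrix.specialUnitaryGroup (Fin N) ℂ)

/-- The real Lie algebra `𝔰𝔲(N)` of skew-Hermitian traceless matrices. -/
def su (N : ℕ) : LieSubalgebra ℝ (Matrix (Fin N) (Fin N) ℂ) where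
  carrier := {A | star A = -A ∧ A.trace = 0}
  add_mem' := by
    rintro A B ⟨hA, tA⟩ ⟨hB, tB⟩
    exact ⟨by rw [star_add, hA, hB]; abel, by rw [Matrix.trace_add, tA, tB, add_zero]⟩
  zero_mem' := ⟨by simp, by simp⟩
  smul_mem' := by
    rintro c A ⟨hA, tA⟩
    exact ⟨by rw [star_smul, hA]; simp, by rw [Matrix.trace_smul, tA, smul_zero]⟩
  lie_mem' := by
    rintro A B ⟨hA, tA⟩ ⟨hB, tB⟩
    refine ⟨?_, ?_⟩
    · rw [Ring.lie_def, star_sub, star_mul, star_mul, hA, hB]; noncomm_ring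
    · rw [Ring.lie_def, Matrix.trace_sub, Matrix.trace_mul_comm, sub_self]

/-- The exponential of an element of `𝔰𝔲(N)` has determinant one. -/
theorem det_exp_of_mem_su {N : ℕ} {A : Matrix (Fin N) (Fin N) ℂ} (hA : A ∈ su N) :
    (NormedSpace.exp A).det = 1 := by
  obtain ⟨h1, h2⟩ := hA
  have hH : (Complex.I • A).IsHermitian := by
    change star (Complex.I • A) = _
    rw [star_smul, h1]; simp
  have hs := hH.spectral_theorem
  set d : Fin N → ℂ := fun i => -Complex.I * (hH.eigenvalues i : ℂ) with hd
  let u : (Matrix (Fin N) (Fin N) ℂ)ˣ := Unitary.toUnits hH.eigenvectorUnitary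
  have hA' : A = u * Matrix.diagonal d * (u⁻¹ : (Matrix (Fin N) (Fin N) ℂ)ˣ) := by
    have : A = (-Complex.I) • (Complex.I • A) := by simp [smul_smul]
    rw [this, hs]
    rw [Unitary.conjStarAlgAut_apply]
    have : Matrix.diagonal d
        = (-Complex.I) • Matrix.diagonal (RCLike.ofReal ∘ hH.eigenvalues) := by
      ext i j
      by_cases h : i = j <;> simp [Matrix.diagonal, hd, h]
    rw [this, mul_smul_comm, smul_mul_assoc]
    rfl
  have htr : ∑ i, d i = 0 := by
    rw [← Matrix.trace_diagonal, ← h2, hA', Matrix.trace_mul_cycle]; simp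
  rw [hA', Matrix.exp_units_conj, Matrix.det_units_conj, Matrix.exp_diagonal, Matrix.det_diagonal]
  have he : ∀ i, NormedSpace.exp d i = Complex.exp (d i) := by
    intro i
    rw [Complex.exp_eq_exp_ℂ]
    exact Pi.coe_exp d i
  simp only [he]
  rw [← Complex.exp_sum, htr, Complex.exp_zero]

/-- The exponential of an element of `𝔰𝔲(N)` is unitary. -/
theorem exp_mem_unitary_of_mem_su {N : ℕ} {A : Matrix (Fin N) (Fin N) ℂ} (hA : A ∈ su N) :
    NormedSpace.exp A ∈ Matrix.unitaryGroup (Fin N) ℂ := by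
  have h1 : Matrix.conjTranspose A = -A := hA.1
  have h2 : star (NormedSpace.exp A) = NormedSpace.exp (-A) := by
    rw [← h1]; exact (Matrix.exp_conjTranspose A).symm
  rw [Matrix.mem_unitaryGroup_iff', h2, ← Matrix.exp_add_of_commute _ _ (Commute.refl A).neg_left,
    neg_add_cancel, NormedSpace.exp_zero]

/-- The exponential map `𝔰𝔲(N) → SU(N)`, given by the matrix exponential. -/
noncomputable def expSU {N : ℕ} (Y : su N) : SU N :=
  ⟨NormedSpace.exp (Y : Matrix (Fin N) (Fin N) ℂ),
    exp_mem_unitary_of_mem_su Y.2, det_exp_of_mem_su Y.2⟩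

/-! ### `C¹` functions and differentials on `SU(N)`

Around `U`, the map `Y ↦ exp(Y) U` is a local parametrisation of `SU(N)` by `𝔰𝔲(N)`, whose
derivative at `0` is the right trivialisation `Y ↦ Y U` from `𝔰𝔲(N)` onto the tangent space
`T_U SU(N) = {Y U | Y ∈ 𝔰𝔲(N)}`. -/

/-- `φ` is of class `C¹` on the open set `Ω ⊆ SU(N)`, read in exponential coordinates. -/
def IsC1On {N : ℕ} (φ : SU N → ℝ) (Ω : Set (SU N)) : Prop :=
  ∀ U ∈ Ω, ContDiffAt ℝ 1 (fun Y : su N => φ (expSU Y * U)) 0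

/-- The differential `Dφ(U)`, as a linear form on `𝔰𝔲(N)` through the right trivialisation:
`differential φ U Y` is `Dφ(U) · (Y U)`, the derivative of `φ` at `U` along the tangent vector
`Y U`. -/
noncomputable def differential {N : ℕ} (φ : SU N → ℝ) (U : SU N) : su N →L[ℝ] ℝ :=
  fderiv ℝ (fun Y : su N => φ (expSU Y * U)) 0

/-! ### Continuous viscosity solutions of `F(U, S, DS) = 0` on an open set of `SU(N)`

`F` is a function of a point `U`, a real number and a covector at `U`, the latter being read
through the right trivialisation. -/

/-- `S ∈ C(closure Ω)` is a viscosity subsolution of `F(U, S, DS) = 0` in `Ω`. -/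
def IsViscositySubsolution {N : ℕ} (Ω : Set (SU N)) (F : SU N → ℝ → (su N →L[ℝ] ℝ) → ℝ)
    (S : SU N → ℝ) : Prop :=
  ContinuousOn S (closure Ω) ∧
    ∀ φ : SU N → ℝ, IsC1On φ Ω → ∀ U ∈ Ω, IsLocalMaxOn (fun W => S W - φ W) Ω U →
      F U (S U) (differential φ U) ≤ 0

/-- `S ∈ C(closure Ω)` is a viscosity supersolution of `F(U, S, DS) = 0` in `Ω`. -/
def IsViscositySupersolution {N : ℕ} (Ω : Set (SU N)) (F : SU N → ℝ → (su N →L[ℝ] ℝ) → ℝ)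
    (S : SU N → ℝ) : Prop :=
  ContinuousOn S (closure Ω) ∧
    ∀ φ : SU N → ℝ, IsC1On φ Ω → ∀ U ∈ Ω, IsLocalMinOn (fun W => S W - φ W) Ω U →
      0 ≤ F U (S U) (differential φ U)

/-- `S` is a continuous viscosity solution of `F(U, S, DS) = 0` in `Ω`. -/
def IsContinuousViscositySolution {N : ℕ} (Ω : Set (SU N))
    (F : SU N → ℝ → (su N →L[ℝ] ℝ) → ℝ) (S : SU N → ℝ) : Prop :=
  IsViscositySubsolution Ω F S ∧ IsViscositySupersolution Ω F S

/-! ### The control system -/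

/-- The set `𝐕` of control values: the unit hypercube `[-1, 1]^m`. -/
def controlValues (m : ℕ) : Set (Fin m → ℝ) := Icc (-1) 1

/-- Piecewise continuity on `[0, ∞)`: finitely many discontinuities on each bounded interval, and
one-sided limits everywhere. -/
def IsPiecewiseContinuous {m : ℕ} (v : ℝ → Fin m → ℝ) : Prop :=
  (∀ b : ℝ, {t ∈ Icc 0 b | ¬ ContinuousWithinAt v (Ici 0) t}.Finite) ∧
  (∀ t : ℝ, 0 ≤ t → ∃ y, Tendsto v (𝓝[>] t) (𝓝 y)) ∧
  (∀ t : ℝ, 0 < t → ∃ y, Tendsto v (𝓝[<] t) (𝓝 y))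

/-- The class of control signals: piecewise continuous functions `[0, ∞) → 𝐕`. (The values at
negative times play no role.) -/
def controls (m : ℕ) : Set (ℝ → Fin m → ℝ) :=
  {v | IsPiecewiseContinuous v ∧ ∀ t, 0 ≤ t → v t ∈ controlValues m}

/-- The element `∑ₖ vₖ Xₖ` of `𝔰𝔲(N)`. -/
noncomputable def generator {N m : ℕ} (X : Fin m → su N) (v : Fin m → ℝ) : su N := ∑ k, v k • X k

/-- `U : [0, ∞) → SU(N)` is the trajectory of `dU/dt = (∑ₖ vₖ(t) Xₖ) U`, `U(0) = U₀`: it is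
continuous and satisfies the equation at every time where the control `v` is continuous. -/
def IsTrajectory {N m : ℕ} (X : Fin m → su N) (v : ℝ → Fin m → ℝ) (U₀ : SU N)
    (U : ℝ → SU N) : Prop :=
  U 0 = U₀ ∧ ContinuousOn U (Ici 0) ∧
    ∀ t, 0 ≤ t → ContinuousWithinAt v (Ici 0) t →
      HasDerivWithinAt (fun s => (U s : Matrix (Fin N) (Fin N) ℂ))
        ((generator X (v t) : Matrix (Fin N) (Fin N) ℂ) * (U t : Matrix (Fin N) (Fin N) ℂ))
        (Ici 0) t

/-- The first time at which the trajectory `U` is in the boundary of the target set `T`; it is `⊤`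
if this never happens. -/
noncomputable def hittingTime {N : ℕ} (T : Set (SU N)) (U : ℝ → SU N) : EReal :=
  sInf {τ : EReal | ∃ t : ℝ, 0 ≤ t ∧ U t ∈ frontier T ∧ τ = (t : EReal)}

/-- The discounted cost `∫₀^τ ℓ(U(s), v(s)) e^{-λ s} ds`, where `τ ∈ [0, ∞]` is the hitting time
of the boundary of the target set. -/
noncomputable def cost {N m : ℕ} (T : Set (SU N)) (ℓ : SU N × (Fin m → ℝ) → ℝ) (lam : ℝ)
    (v : ℝ → Fin m → ℝ) (U : ℝ → SU N) : ℝ :=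
  ∫ s in {s : ℝ | 0 ≤ s ∧ (s : EReal) < hittingTime T U}, ℓ (U s, v s) * Real.exp (-(lam * s))

/-- The value function: the infimum of the cost over all control signals. -/
noncomputable def valueFunction {N m : ℕ} (X : Fin m → su N) (T : Set (SU N))
    (ℓ : SU N × (Fin m → ℝ) → ℝ) (lam : ℝ) (U₀ : SU N) : ℝ :=
  sInf {J : ℝ | ∃ v ∈ controls m, ∃ U : ℝ → SU N, IsTrajectory X v U₀ U ∧ J = cost T ℓ lam v U}

/-- The Hamiltonian `H(U, ζ) = sup_{v ∈ 𝐕} {-ζ · f(U, v) - ℓ(U, v)}`, with `f(U, v) = (∑ₖ vₖ Xₖ) U`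
and the covector `ζ` at `U` read through the right trivialisation. -/
noncomputable def hamiltonian {N m : ℕ} (X : Fin m → su N) (ℓ : SU N × (Fin m → ℝ) → ℝ)
    (U : SU N) (ζ : su N →L[ℝ] ℝ) : ℝ :=
  sSup {h : ℝ | ∃ v ∈ controlValues m, h = -ζ (generator X v) - ℓ (U, v)}

end SpinControl

/-! Continuity of the value function `S` comes from small-time local controllability, and the two
viscosity inequalities come from dynamic programming.

Controllability (`eventually_reach`). The control set contains both `e_k` and `-e_k`, so products of
`exp(t X_k)` with `t` of either sign can be followed, in total time `∑ |t|`. Let `V_ε` be the span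
of the conjugates `g X_k g⁻¹` with `g` reachable within time `ε`. These spaces shrink with `ε`, so
by finite dimension they are constant for small `ε`. Differentiating `exp(t X_k) Z exp(-t X_k)` at
`t = 0` shows that the stable space is invariant under bracketing with each `X_k`; hence it contains
the Lie algebra they generate, all of `𝔰𝔲(N)`. A product of factors `g_i exp(s_i X_{k_i}) g_i⁻¹`,
one for each element of a basis of `V_ε` made of such conjugates, therefore has a differential at `s
= 0` onto `𝔰𝔲(N)`, and covers a neighbourhood of the identity.

Continuity (`continuous_valueFunction`). If `M` bounds the running cost, moving from `U` to `W * U`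
in time `a` gives `S(U) ≤ a M + S(W * U)`, and inverting the path gives the reverse bound. Meeting
`∂T` on the way only lowers the cost, so `S` is continuous on the whole group with no regularity
assumed of `∂T`.

Viscosity inequalities. For a subsolution, a constant control is used on `[0, h]`
(`valueFunction_le_const_control`), `S` is replaced by the test function, and the inequality is
differentiated at `h = 0`. For a supersolution, a control optimal up to `O(h²)` is restarted at time
`h` (`cost_shift_le`); running cost plus the variation of `φ` is at least about `-h H`, uniformly in
the control, which contradicts a strictly negative value of `F`. -/

namespace SpinControl

/-! ### Calculus of the matrix exponential and topology of `SU(N)` -/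

theorem hasStrictFDerivAt_matrix_exp_zero (N : ℕ) :
    HasStrictFDerivAt (𝕜 := ℝ) (NormedSpace.exp : Matrix (Fin N) (Fin N) ℂ → _)
      ((ContinuousLinearEquiv.refl ℝ (Matrix (Fin N) (Fin N) ℂ) :
        Matrix (Fin N) (Fin N) ℂ →L[ℝ] Matrix (Fin N) (Fin N) ℂ)) 0 := by
  -- The entrywise norm is not submultiplicative. The row-sum norm is, and it has the same topology,
  -- hence the same derivatives.
  let : NormedRing (Matrix (Fin N) (Fin N) ℂ) := Matrix.linftyOpNormedRing
  let : NormedAlgebra ℝ (Matrix (Fin N) (Fin N) ℂ) := Matrix.linftyOpNormedAlgebra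
  exact @hasStrictFDerivAt_exp_zero ℝ (Matrix (Fin N) (Fin N) ℂ) _ _ _
    (FiniteDimensional.complete ℝ _)

theorem hasStrictDerivAt_matrix_exp_smul {N : ℕ} (A : Matrix (Fin N) (Fin N) ℂ) (t : ℝ) :
    HasStrictDerivAt (fun t : ℝ => NormedSpace.exp (t • A)) (A * NormedSpace.exp (t • A)) t := by
  let : NormedRing (Matrix (Fin N) (Fin N) ℂ) := Matrix.linftyOpNormedRing
  let : NormedAlgebra ℝ (Matrix (Fin N) (Fin N) ℂ) := Matrix.linftyOpNormedAlgebra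
  exact @hasStrictDerivAt_exp_smul_const' ℝ (Matrix (Fin N) (Fin N) ℂ) _ _ _
    (FiniteDimensional.complete ℝ _) A t

/-- The product rule at a point where both factors are the identity. -/
theorem hasStrictFDerivAt_matrix_mul_of_eq_one {N : ℕ} {E : Type*} [NormedAddCommGroup E]
    [NormedSpace ℝ E] {f g : E → Matrix (Fin N) (Fin N) ℂ}
    {f' g' : E →L[ℝ] Matrix (Fin N) (Fin N) ℂ} {x : E} (hf : HasStrictFDerivAt f f' x)
    (hg : HasStrictFDerivAt g g' x) (hfx : f x = 1) (hgx : g x = 1) :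
    HasStrictFDerivAt (fun y => f y * g y) (f' + g') x := by
  let : NormedRing (Matrix (Fin N) (Fin N) ℂ) := Matrix.linftyOpNormedRing
  let : NormedAlgebra ℝ (Matrix (Fin N) (Fin N) ℂ) := Matrix.linftyOpNormedAlgebra
  have h := HasStrictFDerivAt.mul' (𝕜 := ℝ) (𝔸 := Matrix (Fin N) (Fin N) ℂ) hf hg
  refine h.congr_fderiv (ContinuousLinearMap.ext fun y => ?_)
  change f x * g' y + f' y * g x = f' y + g' y
  rw [hfx, hgx, one_mul, mul_one, add_comm]

/-- The continuous linear map `Y ↦ A Y B` on matrices. -/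
noncomputable def mulLeftRight {N : ℕ} (A B : Matrix (Fin N) (Fin N) ℂ) :
    Matrix (Fin N) (Fin N) ℂ →L[ℝ] Matrix (Fin N) (Fin N) ℂ :=
  LinearMap.toContinuousLinearMap (LinearMap.mulLeftRight ℝ (A, B))

@[simp]
theorem mulLeftRight_apply {N : ℕ} (A B Y : Matrix (Fin N) (Fin N) ℂ) :
    mulLeftRight A B Y = A * Y * B := by
  simp [mulLeftRight]

theorem SU.coe_mul {N : ℕ} (U W : SU N) :
    ((U * W : SU N) : Matrix (Fin N) (Fin N) ℂ) = U * W := rfl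

theorem SU.norm_le_one {N : ℕ} (U : SU N) : ‖(U : Matrix (Fin N) (Fin N) ℂ)‖ ≤ 1 :=
  entrywise_sup_norm_bound_of_unitary U.2.1

instance SU.isTopologicalGroup (N : ℕ) : IsTopologicalGroup (SU N) where
  continuous_inv := Continuous.subtype_mk (continuous_star.comp continuous_subtype_val) _

instance SU.compactSpace (N : ℕ) : CompactSpace (SU N) := by
  refine isCompact_iff_compactSpace.1 (Metric.isCompact_of_isClosed_isBounded ?_ ?_)
  · have h : (Matrix.specialUnitaryGroup (Fin N) ℂ : Set (Matrix (Fin N) (Fin N) ℂ)) =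
        {A | A * star A = 1} ∩ {A | A.det = 1} := by
      ext A
      simp [Matrix.mem_specialUnitaryGroup_iff, Matrix.mem_unitaryGroup_iff]
    rw [h]
    exact (isClosed_eq (by fun_prop) continuous_const).inter
      (isClosed_eq (by fun_prop) continuous_const)
  · refine isBounded_iff_forall_norm_le.2 ⟨1, fun A hA => ?_⟩
    exact SU.norm_le_one ⟨A, hA⟩

theorem expSU_zero {N : ℕ} : expSU (0 : su N) = 1 :=
  Subtype.ext (by simp [expSU])

theorem expSU_add_smul {N : ℕ} (Y : su N) (s t : ℝ) :
    expSU ((s + t) • Y) = expSU (s • Y) * expSU (t • Y) := by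
  refine Subtype.ext ?_
  change NormedSpace.exp ((s + t) • (Y : Matrix (Fin N) (Fin N) ℂ)) =
    NormedSpace.exp (s • (Y : Matrix (Fin N) (Fin N) ℂ)) *
      NormedSpace.exp (t • (Y : Matrix (Fin N) (Fin N) ℂ))
  rw [add_smul]
  exact Matrix.exp_add_of_commute _ _ (((Commute.refl _).smul_left s).smul_right t)

theorem expSU_neg {N : ℕ} (Y : su N) : expSU (-Y) = (expSU Y)⁻¹ := by
  refine eq_inv_of_mul_eq_one_left ?_
  have h := expSU_add_smul Y (-1) 1
  simpa [expSU_zero] using h.symm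

theorem coe_expSU_smul {N : ℕ} (Y : su N) (t : ℝ) :
    ((expSU (t • Y) : SU N) : Matrix (Fin N) (Fin N) ℂ) =
      NormedSpace.exp (t • (Y : Matrix (Fin N) (Fin N) ℂ)) := rfl

theorem continuous_expSU_smul {N : ℕ} (Y : su N) : Continuous fun t : ℝ => expSU (t • Y) := by
  refine continuous_induced_rng.2 (continuous_iff_continuousAt.2 fun t => ?_)
  exact (hasStrictDerivAt_matrix_exp_smul
    (Y : Matrix (Fin N) (Fin N) ℂ) t).hasStrictFDerivAt.continuousAt

theorem hasDerivAt_expSU_smul_mul {N : ℕ} (Y : su N) (U : SU N) (t : ℝ) :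
    HasDerivAt (fun t : ℝ => ((expSU (t • Y) * U : SU N) : Matrix (Fin N) (Fin N) ℂ))
      ((Y : Matrix (Fin N) (Fin N) ℂ) * (expSU (t • Y) * U : SU N)) t := by
  have h := (mulLeftRight 1 (U : Matrix (Fin N) (Fin N) ℂ)).hasFDerivAt.comp_hasDerivAt t
    (hasStrictDerivAt_matrix_exp_smul (Y : Matrix (Fin N) (Fin N) ℂ) t).hasDerivAt
  refine (h.congr_deriv ((mulLeftRight_apply _ _ _).trans
    (by rw [one_mul, mul_assoc]; rfl))).congr_of_eventuallyEq (Eventually.of_forall fun s => ?_)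
  simp [coe_expSU_smul]

/-! ### The logarithm near the identity -/

/-- Skew-Hermitian matrices near `0` whose exponential has determinant one are traceless. -/
theorem trace_eq_zero_of_det_exp {N : ℕ} {A : Matrix (Fin N) (Fin N) ℂ} (hA : star A = -A)
    (hdet : (NormedSpace.exp A).det = 1) (him : |A.trace.im| < 2 * Real.pi) : A.trace = 0 := by
  have hH : (Complex.I • A).IsHermitian := by
    change star (Complex.I • A) = _
    rw [star_smul, hA]; simp
  have hs := hH.spectral_theorem
  set d : Fin N → ℂ := fun i => -Complex.I * (hH.eigenvalues i : ℂ) with hd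
  let u : (Matrix (Fin N) (Fin N) ℂ)ˣ := Unitary.toUnits hH.eigenvectorUnitary
  have hA' : A = u * Matrix.diagonal d * (u⁻¹ : (Matrix (Fin N) (Fin N) ℂ)ˣ) := by
    have : A = (-Complex.I) • (Complex.I • A) := by simp [smul_smul]
    rw [this, hs]
    rw [Unitary.conjStarAlgAut_apply]
    have : Matrix.diagonal d
        = (-Complex.I) • Matrix.diagonal (RCLike.ofReal ∘ hH.eigenvalues) := by
      ext i j
      by_cases h : i = j <;> simp [Matrix.diagonal, hd, h]
    rw [this, mul_smul_comm, smul_mul_assoc]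
    rfl
  have htr : A.trace = ∑ i, d i := by
    rw [← Matrix.trace_diagonal, hA', Matrix.trace_mul_cycle]; simp
  have he : ∀ i, NormedSpace.exp d i = Complex.exp (d i) := by
    intro i
    rw [Complex.exp_eq_exp_ℂ]
    exact Pi.coe_exp d i
  rw [hA', Matrix.exp_units_conj, Matrix.det_units_conj, Matrix.exp_diagonal,
    Matrix.det_diagonal] at hdet
  simp only [he] at hdet
  -- Since `det (exp A) = exp (tr A)`, the trace lies in `2πiℤ`, and the size bound leaves only `0`.
  rw [← Complex.exp_sum, ← htr, Complex.exp_eq_one_iff] at hdet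
  obtain ⟨k, hk⟩ := hdet
  have him' : A.trace.im = k * (2 * Real.pi) := by rw [hk]; simp
  rw [him', abs_mul, abs_of_pos Real.two_pi_pos] at him
  have hk1 : |(k : ℝ)| < 1 := by
    by_contra! h
    nlinarith [Real.two_pi_pos]
  have hk0 : k = 0 := Int.abs_lt_one_iff.1 (by exact_mod_cast hk1)
  rw [hk, hk0]; simp

/-- The matrix logarithm near the identity. -/
noncomputable def matrixLog (N : ℕ) : Matrix (Fin N) (Fin N) ℂ → Matrix (Fin N) (Fin N) ℂ :=
  (hasStrictFDerivAt_matrix_exp_zero N).localInverse _ _ _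

theorem hasStrictFDerivAt_matrixLog (N : ℕ) :
    HasStrictFDerivAt (matrixLog N)
      (ContinuousLinearMap.id ℝ (Matrix (Fin N) (Fin N) ℂ)) 1 := by
  have h := (hasStrictFDerivAt_matrix_exp_zero N).to_localInverse
  rw [NormedSpace.exp_zero] at h
  exact h

theorem matrixLog_one (N : ℕ) : matrixLog N 1 = 0 := by
  have h := (hasStrictFDerivAt_matrix_exp_zero N).localInverse_apply_image
  rw [NormedSpace.exp_zero] at h
  exact h

theorem tendsto_matrixLog (N : ℕ) : Tendsto (matrixLog N) (𝓝 1) (𝓝 0) := by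
  simpa [matrixLog_one] using (hasStrictFDerivAt_matrixLog N).continuousAt.tendsto

theorem eventually_matrixLog_exp (N : ℕ) : ∀ᶠ A in 𝓝 0, matrixLog N (NormedSpace.exp A) = A :=
  (hasStrictFDerivAt_matrix_exp_zero N).eventually_left_inverse

theorem eventually_exp_matrixLog (N : ℕ) : ∀ᶠ A in 𝓝 1, NormedSpace.exp (matrixLog N A) = A := by
  have h := (hasStrictFDerivAt_matrix_exp_zero N).eventually_right_inverse
  rw [NormedSpace.exp_zero] at h
  exact h

/-- Near the identity, the logarithm of an element of `SU(N)` lies in `𝔰𝔲(N)`. -/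
theorem eventually_matrixLog_mem_su (N : ℕ) :
    ∀ᶠ W : SU N in 𝓝 1, matrixLog N W ∈ su N := by
  have hc : Tendsto (fun W : SU N => (W : Matrix (Fin N) (Fin N) ℂ)) (𝓝 1) (𝓝 1) :=
    continuous_subtype_val.tendsto (1 : SU N)
  have hL := (tendsto_matrixLog N).comp hc
  have hneg : Tendsto (fun W : SU N => -star (matrixLog N W)) (𝓝 1) (𝓝 0) := by
    simpa using (hL.star).neg
  have htr : Tendsto (fun W : SU N => |(matrixLog N W).trace.im|) (𝓝 1) (𝓝 0) := by
    have : Continuous fun A : Matrix (Fin N) (Fin N) ℂ => |A.trace.im| := by fun_prop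
    simpa [Function.comp_def] using (this.tendsto 0).comp hL
  filter_upwards [hc.eventually (eventually_exp_matrixLog N),
    hneg.eventually (eventually_matrixLog_exp N),
    htr.eventually (gt_mem_nhds Real.two_pi_pos)] with W h1 h2 h3
  -- Unitarity makes `-(log W)*` a second small logarithm of `W`; local uniqueness then gives `-(log
  -- W)* = log W`.
  have hW : NormedSpace.exp (-star (matrixLog N W)) = (W : Matrix (Fin N) (Fin N) ℂ) := by
    have hi : NormedSpace.exp (matrixLog N W) * NormedSpace.exp (-matrixLog N W) = 1 := by
      rw [← Matrix.exp_add_of_commute _ _ (Commute.refl (matrixLog N W)).neg_right,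
        add_neg_cancel, NormedSpace.exp_zero]
    rw [h1] at hi
    have hi' : NormedSpace.exp (-matrixLog N W) = star (W : Matrix (Fin N) (Fin N) ℂ) := by
      have := congrArg (fun B => star (W : Matrix (Fin N) (Fin N) ℂ) * B) hi
      simpa [← mul_assoc, Matrix.mem_unitaryGroup_iff'.1 W.2.1] using this
    have h4 : -star (matrixLog N W) = Matrix.conjTranspose (-matrixLog N W) := (star_neg _).symm
    rw [h4, Matrix.exp_conjTranspose, hi']
    exact star_star _
  have hskew : star (matrixLog N W) = -matrixLog N W := by
    rw [hW] at h2
    exact neg_eq_iff_eq_neg.1 h2.symm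
  exact ⟨hskew, trace_eq_zero_of_det_exp hskew (by rw [h1]; exact W.2.2) h3⟩

instance su.isUniformAddGroup (N : ℕ) : IsUniformAddGroup (su N) :=
  SeminormedAddCommGroup.to_isUniformAddGroup (E := su N)

/-- There is a continuous linear projection of the matrices onto `𝔰𝔲(N)`. -/
theorem exists_projection_su (N : ℕ) :
    ∃ P : Matrix (Fin N) (Fin N) ℂ →L[ℝ] su N, ∀ Y : su N, P Y = Y := by
  obtain ⟨g, hg⟩ := LinearMap.exists_leftInverse_of_injective
    ((su N).toSubmodule.subtype) (Submodule.ker_subtype _)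
  exact ⟨⟨g, LinearMap.continuous_of_finiteDimensional g⟩, fun Y => LinearMap.congr_fun hg Y⟩

/-! ### Small-time local controllability -/

/-- `Reach X a W` says that `W` is a product of exponentials `exp (t • X k)` with `∑ |t| = a`. -/
inductive Reach {N m : ℕ} (X : Fin m → su N) : ℝ → SU N → Prop
  | one : Reach X 0 1
  | step {a : ℝ} {W : SU N} (k : Fin m) (t : ℝ) (h : Reach X a W) :
      Reach X (|t| + a) (expSU (t • X k) * W)

namespace Reach

variable {N m : ℕ} {X : Fin m → su N} {a b : ℝ} {W W' : SU N}

theorem mul (h : Reach X a W) (h' : Reach X b W') : Reach X (a + b) (W * W') := by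
  induction h with
  | one => simpa using h'
  | step k t _ ih =>
    rw [add_assoc, mul_assoc]
    exact ih.step k t

theorem exp (X : Fin m → su N) (k : Fin m) (t : ℝ) : Reach X |t| (expSU (t • X k)) := by
  simpa using Reach.one.step (X := X) k t

theorem inv (h : Reach X a W) : Reach X a W⁻¹ := by
  induction h with
  | one => simpa using Reach.one
  | step k t _ ih =>
    rw [mul_inv_rev, add_comm, ← expSU_neg, ← neg_smul, ← abs_neg t]
    exact ih.mul (Reach.exp X k (-t))

theorem list_prod {ι : Type*} {f : ι → SU N} (c : ℝ) (l : List ι)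
    (h : ∀ i ∈ l, ∃ a ≤ c, Reach X a (f i)) :
    ∃ a ≤ l.length * c, Reach X a (l.map f).prod := by
  induction l with
  | nil => exact ⟨0, by simp, by simpa using Reach.one⟩
  | cons i l ih =>
    obtain ⟨a, ha, hi⟩ := h i (by simp)
    obtain ⟨b, hb, hl⟩ := ih fun j hj => h j (by simp [hj])
    refine ⟨a + b, ?_, ?_⟩
    · rw [List.length_cons]
      push_cast
      linarith
    · simpa using hi.mul hl

end Reach

theorem hasDerivAt_exp_conj {N : ℕ} (A Z : Matrix (Fin N) (Fin N) ℂ) :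
    HasDerivAt (fun t : ℝ => NormedSpace.exp (t • A) * Z * NormedSpace.exp (t • -A))
      (A * Z - Z * A) 0 := by
  have h1 := (hasStrictDerivAt_matrix_exp_smul A 0).hasDerivAt
  have h2 := (hasStrictDerivAt_matrix_exp_smul (-A) 0).hasDerivAt
  let : NormedRing (Matrix (Fin N) (Fin N) ℂ) := Matrix.linftyOpNormedRing
  let : NormedAlgebra ℝ (Matrix (Fin N) (Fin N) ℂ) := Matrix.linftyOpNormedAlgebra
  have h := HasDerivAt.mul (𝔸 := Matrix (Fin N) (Fin N) ℂ) (HasDerivAt.mul_const h1 Z) h2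
  refine HasDerivAt.congr_deriv h ?_
  simp only [zero_smul, NormedSpace.exp_zero]
  noncomm_ring

theorem coe_expSU_smul_inv {N : ℕ} (Y : su N) (t : ℝ) :
    (((expSU (t • Y))⁻¹ : SU N) : Matrix (Fin N) (Fin N) ℂ) =
      NormedSpace.exp (t • -(Y : Matrix (Fin N) (Fin N) ℂ)) := by
  rw [← expSU_neg, ← smul_neg]
  rfl

/-- The conjugates of the control directions by elements reachable within time `ε`. -/
def conjugates {N m : ℕ} (X : Fin m → su N) (ε : ℝ) : Set (Matrix (Fin N) (Fin N) ℂ) :=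
  {A | ∃ g : SU N, (∃ a ≤ ε, Reach X a g) ∧ ∃ k, A = mulLeftRight (g : Matrix _ _ ℂ)
    ((g⁻¹ : SU N) : Matrix _ _ ℂ) (X k : Matrix (Fin N) (Fin N) ℂ)}

theorem conjugates_mono {N m : ℕ} (X : Fin m → su N) : Monotone (conjugates X) := by
  rintro ε ε' h A ⟨g, ⟨a, ha, hg⟩, k, rfl⟩
  exact ⟨g, ⟨a, ha.trans h, hg⟩, k, rfl⟩

theorem conj_mem_span_conjugates {N m : ℕ} (X : Fin m → su N) {δ ε t : ℝ} (k : Fin m)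
    (ht : |t| + δ ≤ ε) {Z : Matrix (Fin N) (Fin N) ℂ}
    (hZ : Z ∈ Submodule.span ℝ (conjugates X δ)) :
    mulLeftRight (expSU (t • X k) : Matrix _ _ ℂ) ((expSU (t • X k))⁻¹ : SU N) Z ∈
      Submodule.span ℝ (conjugates X ε) := by
  induction hZ using Submodule.span_induction with
  | mem A hA =>
    obtain ⟨g, ⟨a, ha, hg⟩, j, rfl⟩ := hA
    refine Submodule.subset_span ⟨expSU (t • X k) * g, ⟨|t| + a, by linarith, hg.step k t⟩, j, ?_⟩
    simp only [mulLeftRight_apply, mul_inv_rev, SU.coe_mul, mul_assoc]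
  | zero => rw [map_zero]; exact Submodule.zero_mem _
  | add A B _ _ hA hB => rw [map_add]; exact Submodule.add_mem _ hA hB
  | smul c A _ hA => rw [map_smul]; exact Submodule.smul_mem _ c hA

/-- The spans of the conjugates stabilise as the reaching time tends to zero. -/
theorem exists_span_conjugates_eq {N m : ℕ} (X : Fin m → su N) :
    ∃ ε₀ > 0, ∀ ε, 0 < ε → ε ≤ ε₀ →
      Submodule.span ℝ (conjugates X ε) = Submodule.span ℝ (conjugates X ε₀) := by
  -- A minimal span among all `ε > 0` exists by finite dimension; monotonicity makes every smaller
  -- `ε` give the same span.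
  obtain ⟨L, ⟨ε₀, h0, rfl⟩, hL⟩ := WellFounded.has_min
    (wellFounded_lt (α := Submodule ℝ (Matrix (Fin N) (Fin N) ℂ)))
    ((fun ε => Submodule.span ℝ (conjugates X ε)) '' Ioi 0) ⟨_, 1, zero_lt_one' ℝ, rfl⟩
  refine ⟨ε₀, h0, fun ε hε hle => ?_⟩
  have h := Submodule.span_mono (R := ℝ) (conjugates_mono X hle)
  exact h.eq_of_not_lt (hL _ ⟨ε, hε, rfl⟩)

/-- The bracket is the derivative at `0` of `exp(t X_k) Z exp(-t X_k)`. By stability `Z` already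
lies in the span at `ε₀ / 2`, so for `|t| < ε₀ / 2` the curve stays in the span at `ε₀`, which is
closed and so contains the limit of difference quotients. -/
theorem lie_mem_span_conjugates {N m : ℕ} (X : Fin m → su N) {ε₀ : ℝ} (h0 : 0 < ε₀)
    (hε : ∀ ε, 0 < ε → ε ≤ ε₀ →
      Submodule.span ℝ (conjugates X ε) = Submodule.span ℝ (conjugates X ε₀))
    (k : Fin m) {Z : Matrix (Fin N) (Fin N) ℂ} (hZ : Z ∈ Submodule.span ℝ (conjugates X ε₀)) :
    (X k : Matrix (Fin N) (Fin N) ℂ) * Z - Z * (X k : Matrix (Fin N) (Fin N) ℂ) ∈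
      Submodule.span ℝ (conjugates X ε₀) := by
  have hd := hasDerivAt_iff_tendsto_slope.1
    (hasDerivAt_exp_conj (X k : Matrix (Fin N) (Fin N) ℂ) Z)
  have hclosed : IsClosed (Submodule.span ℝ (conjugates X ε₀) : Set (Matrix (Fin N) (Fin N) ℂ)) :=
    Submodule.closed_of_finiteDimensional _
  refine hclosed.mem_of_tendsto hd ?_
  have hsmall : ∀ᶠ t : ℝ in 𝓝[≠] 0, |t| < ε₀ / 2 :=
    ((continuous_abs.tendsto (0 : ℝ)).eventually
      (gt_mem_nhds (by simpa using half_pos h0))).filter_mono nhdsWithin_le_nhds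
  filter_upwards [hsmall] with t ht
  rw [slope_def_module]
  refine Submodule.smul_mem _ _ (Submodule.sub_mem _ ?_ (by simpa using hZ))
  have h := conj_mem_span_conjugates X (δ := ε₀ / 2) (ε := ε₀) (t := t) k (by linarith)
    (Z := Z) (by rw [hε _ (half_pos h0) (by linarith)]; exact hZ)
  rw [mulLeftRight_apply, coe_expSU_smul, coe_expSU_smul_inv] at h
  exact h

/-- By the Jacobi identity, the elements whose bracket preserves the stable span form a Lie
subalgebra; it contains every `X_k`, so it is everything. The span also contains each `X_k`
(conjugation by `1`), and so every iterated bracket. -/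
theorem su_le_span_conjugates {N m : ℕ} (X : Fin m → su N)
    (hX : LieSubalgebra.lieSpan ℝ (su N) (Set.range X) = ⊤) {ε : ℝ} (hε : 0 < ε) (Y : su N) :
    (Y : Matrix (Fin N) (Fin N) ℂ) ∈ Submodule.span ℝ (conjugates X ε) := by
  obtain ⟨ε₀, h0, hstab⟩ := exists_span_conjugates_eq X
  suffices h : (Y : Matrix (Fin N) (Fin N) ℂ) ∈ Submodule.span ℝ (conjugates X ε₀) by
    rcases le_total ε ε₀ with hle | hle
    · rwa [hstab ε hε hle]
    · exact Submodule.span_mono (conjugates_mono X hle) h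
  have hideal : ∀ Y : su N, ∀ Z ∈ Submodule.span ℝ (conjugates X ε₀),
      (Y : Matrix (Fin N) (Fin N) ℂ) * Z - Z * (Y : Matrix (Fin N) (Fin N) ℂ) ∈
        Submodule.span ℝ (conjugates X ε₀) := by
    intro Y
    have hY : Y ∈ LieSubalgebra.lieSpan ℝ (su N) (Set.range X) := by rw [hX]; trivial
    induction hY using LieSubalgebra.lieSpan_induction with
    | mem y hy =>
      obtain ⟨k, rfl⟩ := hy
      exact fun Z hZ => lie_mem_span_conjugates X h0 hstab k hZ
    | zero => intro Z _; simp
    | add A B _ _ hA hB =>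
      intro Z hZ
      have := Submodule.add_mem _ (hA Z hZ) (hB Z hZ)
      convert this using 1
      change ((A : Matrix (Fin N) (Fin N) ℂ) + (B : Matrix (Fin N) (Fin N) ℂ)) * Z -
        Z * ((A : Matrix (Fin N) (Fin N) ℂ) + (B : Matrix (Fin N) (Fin N) ℂ)) = _
      noncomm_ring
    | smul c A _ hA =>
      intro Z hZ
      have := Submodule.smul_mem _ c (hA Z hZ)
      convert this using 1
      change (c • (A : Matrix (Fin N) (Fin N) ℂ)) * Z -
        Z * (c • (A : Matrix (Fin N) (Fin N) ℂ)) = _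
      rw [smul_sub, smul_mul_assoc, mul_smul_comm]
    | lie A B _ _ hA hB =>
      intro Z hZ
      have := Submodule.sub_mem _ (hA _ (hB Z hZ)) (hB _ (hA Z hZ))
      convert this using 1
      rw [LieSubalgebra.coe_bracket, Ring.lie_def]; noncomm_ring
  have hY : Y ∈ LieSubalgebra.lieSpan ℝ (su N) (Set.range X) := by rw [hX]; trivial
  induction hY using LieSubalgebra.lieSpan_induction with
  | mem y hy =>
    obtain ⟨k, rfl⟩ := hy
    refine Submodule.subset_span ⟨1, ⟨0, h0.le, Reach.one⟩, k, ?_⟩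
    rw [mulLeftRight_apply, inv_one]
    simp
  | zero => exact Submodule.zero_mem _
  | add A B _ _ hA hB => exact Submodule.add_mem _ hA hB
  | smul c A _ hA => exact Submodule.smul_mem _ c hA
  | lie A B _ _ hA hB =>
    rw [LieSubalgebra.coe_bracket, Ring.lie_def]
    exact hideal A _ hB

/-- All factors equal `1` at the base point, so the order of multiplication leaves no trace in the
derivative. -/
theorem hasStrictFDerivAt_list_prod_of_eq_one {N : ℕ} {ι : Type*} [Fintype ι]
    {c : ι → ℝ → Matrix (Fin N) (Fin N) ℂ} {a : ι → Matrix (Fin N) (Fin N) ℂ}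
    (hc : ∀ i, HasStrictDerivAt (c i) (a i) 0) (h1 : ∀ i, c i 0 = 1) (l : List ι) :
    HasStrictFDerivAt (fun s : ι → ℝ => (l.map fun i => c i (s i)).prod)
      (l.map fun i => (ContinuousLinearMap.proj (R := ℝ) (φ := fun _ : ι => ℝ) i).smulRight
        (a i)).sum 0 := by
  induction l with
  | nil => simpa using hasStrictFDerivAt_const (𝕜 := ℝ) (1 : Matrix (Fin N) (Fin N) ℂ) (0 : ι → ℝ)
  | cons i l ih =>
    simp only [List.map_cons, List.prod_cons, List.sum_cons]
    refine hasStrictFDerivAt_matrix_mul_of_eq_one ?_ ih (h1 i) ?_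
    · have hp : HasStrictFDerivAt (fun s : ι → ℝ => s i)
          (ContinuousLinearMap.proj (R := ℝ) (φ := fun _ : ι => ℝ) i) 0 :=
        (ContinuousLinearMap.proj (R := ℝ) (φ := fun _ : ι => ℝ) i).hasStrictFDerivAt
      have hi : HasStrictDerivAt (c i) (a i) ((0 : ι → ℝ) i) := hc i
      refine (hi.hasStrictFDerivAt.comp (0 : ι → ℝ) hp).congr_fderiv
        (ContinuousLinearMap.ext fun s => ?_)
      rfl
    · simp [h1]

/-- Small-time local controllability: if the control directions generate `𝔰𝔲(N)`, a neighbourhood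
of the identity is reached within any given positive time. -/
theorem eventually_reach {N m : ℕ} (X : Fin m → su N)
    (hX : LieSubalgebra.lieSpan ℝ (su N) (Set.range X) = ⊤) {ε : ℝ} (hε : 0 < ε) :
    ∀ᶠ W : SU N in 𝓝 1, ∃ a ≤ ε, Reach X a W := by
  set d : ℝ := ((Module.finrank ℝ (Matrix (Fin N) (Fin N) ℂ) : ℕ) : ℝ) with hd
  -- At most `d` factors `g exp(s X_k) g⁻¹` occur, and each takes time at most `3η`. The `+ 1` keeps
  -- the quotient meaningful when `d = 0`.
  set η : ℝ := ε / (3 * (d + 1)) with hη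
  have hd0 : 0 ≤ d := Nat.cast_nonneg _
  have hη0 : 0 < η := by positivity
  obtain ⟨b, hbsub, hbspan, hbind⟩ := exists_linearIndependent ℝ (conjugates X η)
  have : Fintype b := Set.Finite.fintype hbind.setFinite
  choose g hg k hk using fun i : b => hbsub i.2
  have hcard : (Fintype.card b : ℝ) ≤ d := by
    exact Nat.cast_le.2 hbind.fintype_card_le_finrank
  let c : b → ℝ → SU N := fun i t => g i * expSU (t • X (k i)) * (g i)⁻¹
  let Ψ : (b → ℝ) → SU N := fun s => (Finset.univ.toList.map fun i => c i (s i)).prod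
  have hreach : ∀ s : b → ℝ, (∀ i, |s i| ≤ η) → ∃ a ≤ ε, Reach X a (Ψ s) := by
    intro s hs
    obtain ⟨a, ha, h⟩ := Reach.list_prod (X := X) (f := fun i => c i (s i)) (3 * η)
      Finset.univ.toList fun i _ => by
        obtain ⟨a, ha, h⟩ := hg i
        exact ⟨a + |s i| + a, by linarith [hs i], (h.mul (Reach.exp X (k i) (s i))).mul h.inv⟩
    refine ⟨a, ha.trans ?_, h⟩
    rw [Finset.length_toList, Finset.card_univ]
    calc (Fintype.card b : ℝ) * (3 * η) ≤ (d + 1) * (3 * η) := by gcongr; linarith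
      _ = ε := by rw [hη]; field_simp
  have hc : ∀ i, HasStrictDerivAt (fun t => (c i t : Matrix (Fin N) (Fin N) ℂ)) (i : _) 0 := by
    intro i
    have h := (mulLeftRight (g i : Matrix (Fin N) (Fin N) ℂ)
      ((g i)⁻¹ : SU N)).hasStrictFDerivAt.comp_hasStrictDerivAt (0 : ℝ)
      (hasStrictDerivAt_matrix_exp_smul (X (k i) : Matrix (Fin N) (Fin N) ℂ) 0)
    rw [zero_smul, NormedSpace.exp_zero, mul_one] at h
    exact ((h.congr_deriv (hk i).symm).congr_of_eventuallyEq
      (Eventually.of_forall fun t => mulLeftRight_apply _ _ _))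
  have hc1 : ∀ i, c i 0 = 1 := by
    intro i
    simp only [c]
    rw [zero_smul, expSU_zero, mul_one, mul_inv_cancel]
  have hΨ0 : Ψ 0 = 1 := by simp [Ψ, hc1]
  have hΨ : HasStrictFDerivAt (fun s => (Ψ s : Matrix (Fin N) (Fin N) ℂ))
      (Finset.univ.toList.map fun i : b =>
        (ContinuousLinearMap.proj (R := ℝ) (φ := fun _ : b => ℝ) i).smulRight
          (i : Matrix (Fin N) (Fin N) ℂ)).sum 0 := by
    have h := hasStrictFDerivAt_list_prod_of_eq_one hc (fun i => by rw [hc1]; rfl)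
      Finset.univ.toList
    refine h.congr_of_eventuallyEq (Eventually.of_forall fun s => ?_)
    simp only [Ψ, Submonoid.coe_list_prod, List.map_map]
    rfl
  obtain ⟨P, hP⟩ := exists_projection_su N
  have hlog : HasStrictFDerivAt (matrixLog N)
      (ContinuousLinearMap.id ℝ (Matrix (Fin N) (Fin N) ℂ)) ((Ψ 0 : SU N) : Matrix _ _ ℂ) := by
    rw [hΨ0]; exact hasStrictFDerivAt_matrixLog N
  -- Reading `Ψ` through `P ∘ log` gives a map into the vector space `𝔰𝔲(N)`, where a surjective
  -- strict derivative makes the map open at `0`.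
  have hF := P.hasStrictFDerivAt.comp (0 : b → ℝ)
    (HasStrictFDerivAt.comp (g := matrixLog N) (0 : b → ℝ) hlog hΨ)
  have hmap := hF.map_nhds_eq_of_surj (by
    refine LinearMap.range_eq_top.2 fun Y => ?_
    have hY := su_le_span_conjugates X hX hη0 Y
    rw [← hbspan, ← Subtype.range_coe (s := b), Submodule.mem_span_range_iff_exists_fun] at hY
    obtain ⟨r, hr⟩ := hY
    refine ⟨r, ?_⟩
    rw [← hP Y, ← hr]
    rw [Finset.sum_map_toList]
    change P ((∑ i : b, (ContinuousLinearMap.proj (R := ℝ) (φ := fun _ : b => ℝ) i).smulRight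
      (i : Matrix (Fin N) (Fin N) ℂ)) r) = _
    rw [_root_.sum_apply]
    rfl)
  have hcΨ : Tendsto Ψ (𝓝 0) (𝓝 1) := by
    refine tendsto_subtype_rng.2 ?_
    have := hΨ.continuousAt.tendsto
    rwa [hΨ0] at this
  have hcoe : Tendsto (fun W : SU N => (W : Matrix (Fin N) (Fin N) ℂ)) (𝓝 1) (𝓝 1) :=
    continuous_subtype_val.tendsto (1 : SU N)
  have hgood : ∀ᶠ W : SU N in 𝓝 1, matrixLog N W ∈ su N ∧
      NormedSpace.exp (matrixLog N W) = (W : Matrix (Fin N) (Fin N) ℂ) :=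
    (eventually_matrixLog_mem_su N).and (hcoe.eventually (eventually_exp_matrixLog N))
  have hball : ∀ᶠ s : b → ℝ in 𝓝 0, ∀ i, |s i| ≤ η := by
    filter_upwards [Metric.closedBall_mem_nhds (0 : b → ℝ) hη0] with s hs i
    exact (norm_le_pi_norm s i).trans (by simpa using hs)
  have himg := image_mem_map (m := fun s => P (matrixLog N (Ψ s)))
    (hball.and (hcΨ.eventually hgood))
  rw [hmap] at himg
  have hlim : Tendsto (fun W : SU N => P (matrixLog N W)) (𝓝 1)
      (𝓝 (P (matrixLog N (Ψ 0)))) := by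
    have h := (P.continuous.tendsto 0).comp ((tendsto_matrixLog N).comp hcoe)
    have h0 : P (matrixLog N (Ψ 0)) = P 0 := by
      rw [hΨ0]
      exact congrArg P (matrixLog_one N)
    rw [h0]
    exact h
  filter_upwards [hlim.eventually himg, hgood] with W hW hWlog
  obtain ⟨s, ⟨hs, hslog, hsexp⟩, hsW⟩ := hW
  -- Both logarithms already lie in `𝔰𝔲(N)`, so `P` loses nothing.
  have heq : matrixLog N (Ψ s) = matrixLog N W := by
    have h1 := hP ⟨_, hslog⟩
    have h2 := hP ⟨_, hWlog.1⟩
    exact congrArg Subtype.val (h1.symm.trans (hsW.trans h2))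
  have hWs : Ψ s = W := Subtype.ext (by rw [← hsexp, heq, hWlog.2])
  rw [← hWs]
  exact hreach s hs

/-! ### Concatenation and time shift of controls and trajectories -/

/-- The concatenation of `f` on `[0, h)` with `g`, started at time `h`. -/
noncomputable def concat {α : Type*} (h : ℝ) (f g : ℝ → α) (t : ℝ) : α :=
  if t < h then f t else g (t - h)

section concat

variable {α : Type*} {h t : ℝ} {f g : ℝ → α}

theorem concat_of_lt (ht : t < h) : concat h f g t = f t := if_pos ht

theorem concat_of_le (ht : h ≤ t) : concat h f g t = g (t - h) := if_neg ht.not_gt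

theorem concat_of_eq (hfg : f h = g 0) (ht : t ≤ h) : concat h f g t = f t := by
  rcases ht.lt_or_eq with ht | rfl
  · exact concat_of_lt ht
  · rw [concat_of_le le_rfl, sub_self, hfg]

theorem concat_eventuallyEq_left (ht : t < h) : concat h f g =ᶠ[𝓝 t] f := by
  filter_upwards [gt_mem_nhds ht] with s hs using concat_of_lt hs

theorem concat_eventuallyEq_right (ht : h < t) : concat h f g =ᶠ[𝓝 t] fun s => g (s - h) := by
  filter_upwards [lt_mem_nhds ht] with s hs using concat_of_le hs.le

end concat

theorem tendsto_sub_nhdsGT (h t : ℝ) : Tendsto (fun s => s - h) (𝓝[>] t) (𝓝[>] (t - h)) := by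
  refine tendsto_nhdsWithin_iff.2 ⟨?_, ?_⟩
  · exact ((continuous_id.sub continuous_const).tendsto t).mono_left nhdsWithin_le_nhds
  · filter_upwards [self_mem_nhdsWithin] with s hs using sub_lt_sub_right hs h

theorem tendsto_sub_nhdsLT (h t : ℝ) : Tendsto (fun s => s - h) (𝓝[<] t) (𝓝[<] (t - h)) := by
  refine tendsto_nhdsWithin_iff.2 ⟨?_, ?_⟩
  · exact ((continuous_id.sub continuous_const).tendsto t).mono_left nhdsWithin_le_nhds
  · filter_upwards [self_mem_nhdsWithin] with s hs using sub_lt_sub_right hs h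

theorem continuousWithinAt_comp_add {α : Type*} [TopologicalSpace α] {v : ℝ → α} {h t : ℝ}
    (hh : 0 ≤ h) (hv : ContinuousWithinAt v (Ici 0) (t + h)) :
    ContinuousWithinAt (fun s => v (s + h)) (Ici 0) t :=
  ContinuousWithinAt.comp (f := fun s : ℝ => s + h) (t := Ici 0) hv
    (continuous_id.add continuous_const).continuousWithinAt
    fun s (hs : 0 ≤ s) => (add_nonneg hs hh : 0 ≤ s + h)

theorem const_mem_controls {m : ℕ} {w : Fin m → ℝ} (hw : w ∈ controlValues m) :
    (fun _ => w) ∈ controls m := by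
  refine ⟨⟨fun b => ?_, fun t _ => ⟨w, tendsto_const_nhds⟩, fun t _ => ⟨w, tendsto_const_nhds⟩⟩,
    fun _ _ => hw⟩
  simp [continuousWithinAt_const]

theorem concat_mem_controls {m : ℕ} {w : Fin m → ℝ} (hw : w ∈ controlValues m)
    {v : ℝ → Fin m → ℝ} (hv : v ∈ controls m) (h : ℝ) :
    concat h (fun _ => w) v ∈ controls m := by
  obtain ⟨⟨hfin, hright, hleft⟩, hval⟩ := hv
  refine ⟨⟨fun b => ?_, fun t _ => ?_, fun t _ => ?_⟩, fun t _ => ?_⟩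
  · refine (((hfin (b - h)).image (· + h)).insert h).subset ?_
    rintro t ⟨⟨h0, hb⟩, hn⟩
    rcases lt_trichotomy t h with ht | rfl | ht
    · exact absurd (continuousAt_const.congr
        (concat_eventuallyEq_left ht).symm).continuousWithinAt hn
    · exact mem_insert _ _
    · refine mem_insert_of_mem _ ⟨t - h, ⟨⟨by linarith, by linarith⟩, fun hc => hn ?_⟩, by simp⟩
      have hc' : ContinuousAt v (t - h) := hc.continuousAt (Ici_mem_nhds (by linarith))
      exact (ContinuousAt.congr (f := fun s => v (s - h))
        (ContinuousAt.comp' hc' (continuous_id.sub continuous_const).continuousAt)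
        (concat_eventuallyEq_right ht).symm).continuousWithinAt
  · rcases lt_or_ge t h with ht | ht
    · exact ⟨w, (tendsto_const_nhds.congr'
        (concat_eventuallyEq_left ht).symm).mono_left nhdsWithin_le_nhds⟩
    · obtain ⟨y, hy⟩ := hright (t - h) (by linarith)
      refine ⟨y, (hy.comp (tendsto_sub_nhdsGT h t)).congr' ?_⟩
      filter_upwards [self_mem_nhdsWithin] with s hs
      exact (concat_of_le (ht.trans (le_of_lt hs))).symm
  · rcases le_or_gt t h with ht | ht
    · refine ⟨w, tendsto_const_nhds.congr' ?_⟩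
      filter_upwards [self_mem_nhdsWithin] with s hs
      exact (concat_of_lt (f := fun _ => w) (lt_of_lt_of_le hs ht)).symm
    · obtain ⟨y, hy⟩ := hleft (t - h) (by linarith)
      exact ⟨y, (hy.comp (tendsto_sub_nhdsLT h t)).congr'
        ((concat_eventuallyEq_right ht).symm.filter_mono nhdsWithin_le_nhds)⟩
  · rcases lt_or_ge t h with ht | ht
    · rwa [concat_of_lt ht]
    · rw [concat_of_le ht]
      exact hval _ (by linarith)

theorem shift_mem_controls {m : ℕ} {v : ℝ → Fin m → ℝ} (hv : v ∈ controls m) {h : ℝ}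
    (hh : 0 ≤ h) : (fun t => v (t + h)) ∈ controls m := by
  obtain ⟨⟨hfin, hright, hleft⟩, hval⟩ := hv
  refine ⟨⟨fun b => ?_, fun t ht => ?_, fun t ht => ?_⟩, fun t ht => hval _ (by linarith)⟩
  · refine ((hfin (b + h)).image (· - h)).subset ?_
    rintro t ⟨⟨h0, hb⟩, hn⟩
    exact ⟨t + h, ⟨⟨by linarith, by linarith⟩, fun hc => hn (continuousWithinAt_comp_add hh hc)⟩,
      by simp⟩
  · obtain ⟨y, hy⟩ := hright (t + h) (by linarith)
    refine ⟨y, hy.comp ?_⟩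
    simpa using tendsto_sub_nhdsGT (-h) t
  · obtain ⟨y, hy⟩ := hleft (t + h) (by linarith)
    refine ⟨y, hy.comp ?_⟩
    simpa using tendsto_sub_nhdsLT (-h) t

theorem isTrajectory_const {N m : ℕ} (X : Fin m → su N) (w : Fin m → ℝ) (U₀ : SU N) :
    IsTrajectory X (fun _ => w) U₀ fun t => expSU (t • generator X w) * U₀ := by
  refine ⟨by simp [expSU_zero], ?_, fun t _ _ => ?_⟩
  · exact ((continuous_expSU_smul _).mul continuous_const).continuousOn
  · exact (hasDerivAt_expSU_smul_mul _ _ _).hasDerivWithinAt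

theorem isTrajectory_concat {N m : ℕ} {X : Fin m → su N} {w : Fin m → ℝ} {U₀ : SU N}
    {v : ℝ → Fin m → ℝ} {U : ℝ → SU N} {h : ℝ} (hh : 0 < h)
    (hU : IsTrajectory X v (expSU (h • generator X w) * U₀) U) :
    IsTrajectory X (concat h (fun _ => w) v) U₀
      (concat h (fun t => expSU (t • generator X w) * U₀) U) := by
  obtain ⟨hU0, hUc, hUd⟩ := hU
  obtain ⟨hf0, hfc, -⟩ := isTrajectory_const X w U₀
  set f : ℝ → SU N := fun t => expSU (t • generator X w) * U₀ with hf
  have hfd : ∀ t, HasDerivAt (fun t => (f t : Matrix (Fin N) (Fin N) ℂ))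
      ((generator X w : Matrix (Fin N) (Fin N) ℂ) * f t) t :=
    hasDerivAt_expSU_smul_mul (generator X w) U₀
  have hfU : f h = U 0 := hU0.symm
  have hcover : Ici (0 : ℝ) ⊆ Icc 0 h ∪ Ici h := by
    intro t ht
    rcases le_total t h with h1 | h1
    · exact Or.inl ⟨ht, h1⟩
    · exact Or.inr h1
  have hleft : EqOn (concat h f U) f (Icc 0 h) := fun t ht => concat_of_eq hfU ht.2
  have hright : EqOn (concat h f U) (fun t => U (t - h)) (Ici h) := fun t ht => concat_of_le ht
  refine ⟨by rw [concat_of_lt hh]; exact hf0, ?_, fun t ht hvt => ?_⟩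
  · refine ContinuousOn.mono (ContinuousOn.union_of_isClosed ?_ ?_ isClosed_Icc isClosed_Ici) hcover
    · exact (hfc.mono fun t ht => ht.1).congr hleft
    · refine ContinuousOn.congr ?_ hright
      exact hUc.comp (continuous_id.sub continuous_const).continuousOn
        fun t (ht : h ≤ t) => sub_nonneg.2 ht
  · rcases lt_trichotomy t h with hlt | rfl | hlt
    · rw [concat_of_lt hlt, concat_of_lt hlt]
      refine ((hfd t).congr_of_eventuallyEq ?_).hasDerivWithinAt
      filter_upwards [concat_eventuallyEq_left (f := f) (g := U) hlt] with s hs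
      rw [hs]
    -- At the junction the equation is required only if the joined control is continuous there. Then
    -- `v 0 = w`, and the two one-sided derivatives agree.
    · have hv0 : ContinuousWithinAt v (Ici 0) 0 := by
        have h1 := continuousWithinAt_comp_add (t := 0) hh.le (by simpa using hvt)
        refine h1.congr (fun s hs => ?_) ?_
        · rw [concat_of_le (by simpa using hs)]; simp
        · rw [concat_of_le (by simp)]; simp
      have hw : v 0 = w := by
        have h1 : Tendsto (concat t (fun _ => w) v) (𝓝[<] t) (𝓝 (v 0)) := by
          have h2 := (hvt.continuousAt (Ici_mem_nhds hh)).tendsto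
          rw [concat_of_le le_rfl, sub_self] at h2
          exact h2.mono_left nhdsWithin_le_nhds
        refine tendsto_nhds_unique h1 (tendsto_const_nhds.congr' ?_)
        filter_upwards [self_mem_nhdsWithin] with s hs
        exact (concat_of_lt (f := fun _ => w) hs).symm
      rw [concat_of_le le_rfl, concat_of_le le_rfl, sub_self]
      refine HasDerivWithinAt.mono (HasDerivWithinAt.union (s := Icc 0 t) (t := Ici t) ?_ ?_) hcover
      · have h1 := (hfd t).hasDerivWithinAt (s := Icc 0 t)
        rw [hfU, ← hw] at h1
        exact h1.congr (fun s hs => by rw [hleft hs]) (by rw [hleft (right_mem_Icc.2 hh.le)])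
      · have h1 : HasDerivWithinAt (fun s => (U (s - t) : Matrix (Fin N) (Fin N) ℂ))
            ((generator X (v 0) : Matrix (Fin N) (Fin N) ℂ) * U 0) (Ici t) t := by
          have h2 := hUd 0 le_rfl hv0
          rw [← sub_self t] at h2
          have h3 := HasDerivWithinAt.scomp (h := fun s : ℝ => s - t) (s := Ici t) t h2
            ((hasDerivAt_id t).sub_const t).hasDerivWithinAt
            fun s (hs : t ≤ s) => (by simpa using hs)
          rw [one_smul, sub_self] at h3
          exact h3
        exact h1.congr (fun s hs => by rw [hright hs]) (by rw [hright (mem_Ici.2 le_rfl)])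
    · rw [concat_of_le hlt.le, concat_of_le hlt.le]
      have hvc : ContinuousWithinAt v (Ici 0) (t - h) := by
        have h1 : ContinuousAt (fun s => concat h (fun _ => w) v (s + h)) (t - h) := by
          have h2 := hvt.continuousAt (Ici_mem_nhds (hh.trans hlt))
          rw [← sub_add_cancel t h] at h2
          exact ContinuousAt.comp' h2 (continuous_id.add continuous_const).continuousAt
        refine (h1.congr ?_).continuousWithinAt
        filter_upwards [lt_mem_nhds (sub_pos.2 hlt)] with s hs
        rw [concat_of_le (by linarith), add_sub_cancel_right]
      have hd := (hUd (t - h) (by linarith) hvc).hasDerivAt (Ici_mem_nhds (by linarith))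
      refine ((HasDerivAt.comp_sub_const t h hd).congr_of_eventuallyEq ?_).hasDerivWithinAt
      filter_upwards [concat_eventuallyEq_right (f := f) (g := U) hlt] with s hs
      rw [hs]

/-- Continuity of `v` at `h` is what supplies the equation at the new initial time: the shifted
control may be continuous from the right at `0` even when `v` jumps at `h`, where the original
trajectory is under no constraint. -/
theorem isTrajectory_shift {N m : ℕ} {X : Fin m → su N} {v : ℝ → Fin m → ℝ} {U₀ : SU N}
    {U : ℝ → SU N} (hU : IsTrajectory X v U₀ U) {h : ℝ} (hh : 0 < h)
    (hvh : ContinuousWithinAt v (Ici 0) h) :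
    IsTrajectory X (fun t => v (t + h)) (U h) fun t => U (t + h) := by
  obtain ⟨-, hUc, hUd⟩ := hU
  refine ⟨by simp, ?_, fun t ht hvt => ?_⟩
  · exact hUc.comp (continuous_id.add continuous_const).continuousOn
      fun t (ht : 0 ≤ t) => (by positivity : (0 : ℝ) ≤ t + h)
  · have hvc : ContinuousWithinAt v (Ici 0) (t + h) := by
      rcases ht.eq_or_lt with rfl | ht
      · rwa [zero_add]
      · have h1 := hvt.continuousAt (Ici_mem_nhds ht)
        have h2 : ContinuousAt (fun s => v (s - h + h)) (t + h) := by
          rw [← add_sub_cancel_right t h] at h1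
          exact ContinuousAt.comp' (f := fun s => s - h) h1
            (continuous_id.sub continuous_const).continuousAt
        simpa using h2.continuousWithinAt
    have hd := (hUd (t + h) (by linarith) hvc).hasDerivAt (Ici_mem_nhds (by linarith))
    exact (HasDerivAt.comp_add_const t h hd).hasDerivWithinAt

/-! ### Hitting times, costs and dynamic programming -/

/-- The margin `r > s` avoids having to know that the infimum is attained. -/
theorem lt_hittingTime_iff {N : ℕ} {T : Set (SU N)} {U : ℝ → SU N} {s : ℝ} :
    (s : EReal) < hittingTime T U ↔ ∃ r > s, ∀ t, 0 ≤ t → U t ∈ frontier T → r ≤ t := by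
  constructor
  · intro h
    obtain ⟨r, hsr, hr⟩ := EReal.lt_iff_exists_real_btwn.1 h
    refine ⟨r, EReal.coe_lt_coe_iff.1 hsr, fun t ht hUt => ?_⟩
    exact EReal.coe_le_coe_iff.1 (hr.le.trans (sInf_le ⟨t, ht, hUt, rfl⟩))
  · rintro ⟨r, hsr, hr⟩
    refine (EReal.coe_lt_coe_iff.2 hsr).trans_le (le_sInf ?_)
    rintro τ ⟨t, ht, hUt, rfl⟩
    exact EReal.coe_le_coe_iff.2 (hr t ht hUt)

theorem measurableSet_lt_hittingTime {N : ℕ} (T : Set (SU N)) (U : ℝ → SU N) :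
    MeasurableSet {s : ℝ | 0 ≤ s ∧ (s : EReal) < hittingTime T U} :=
  measurableSet_Ici.inter (measurable_coe_real_ereal measurableSet_Iio)

theorem countable_not_continuousWithinAt {m : ℕ} {v : ℝ → Fin m → ℝ} (hv : v ∈ controls m) :
    {t : ℝ | 0 ≤ t ∧ ¬ ContinuousWithinAt v (Ici 0) t}.Countable := by
  refine (countable_iUnion fun n : ℕ => (hv.1.1 n).countable).mono ?_
  rintro t ⟨h0, ht⟩
  obtain ⟨n, hn⟩ := exists_nat_ge t
  exact mem_iUnion.2 ⟨n, ⟨h0, hn⟩, ht⟩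

/-- A continuous function of the state and the control is measurable in time along trajectories. -/
theorem aestronglyMeasurable_comp_control {N m : ℕ} {E : Type*} [NormedAddCommGroup E]
    {F : SU N × (Fin m → ℝ) → E} (hF : ContinuousOn F (univ ×ˢ controlValues m))
    {v : ℝ → Fin m → ℝ} (hv : v ∈ controls m) {U : ℝ → SU N} (hU : ContinuousOn U (Ici 0)) :
    AEStronglyMeasurable (fun s => F (U s, v s)) (volume.restrict (Ici 0)) := by
  set D := {t : ℝ | 0 ≤ t ∧ ¬ ContinuousWithinAt v (Ici 0) t} with hD
  have hDc : D.Countable := countable_not_continuousWithinAt hv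
  have hcont : ContinuousOn (fun s => F (U s, v s)) (Ici 0 \ D) := by
    refine hF.comp (ContinuousOn.prodMk (hU.mono sdiff_subset) fun t ht => ?_)
      fun t ht => ⟨mem_univ _, hv.2 t ht.1⟩
    by_contra hc
    exact ht.2 ⟨ht.1, fun h => hc (h.mono sdiff_subset)⟩
  have h := hcont.aestronglyMeasurable (μ := volume) (measurableSet_Ici.diff hDc.measurableSet)
  rwa [Measure.restrict_congr_set (sdiff_null_ae_eq_self (hDc.measure_zero volume))] at h

theorem isCompact_controlValues (m : ℕ) : IsCompact (controlValues m) := isCompact_Icc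

theorem exists_pos_bound {N m : ℕ} {E : Type*} [NormedAddCommGroup E]
    {F : SU N × (Fin m → ℝ) → E} (hF : ContinuousOn F (univ ×ˢ controlValues m)) :
    ∃ M > 0, ∀ U, ∀ v ∈ controlValues m, ‖F (U, v)‖ ≤ M := by
  obtain ⟨C, hC⟩ := (isCompact_univ.prod (isCompact_controlValues m)).exists_bound_of_continuousOn hF
  exact ⟨max C 1, lt_max_of_lt_right one_pos,
    fun U v hv => (hC (U, v) ⟨mem_univ _, hv⟩).trans (le_max_left _ _)⟩

section cost

variable {N m : ℕ} {ℓ : SU N × (Fin m → ℝ) → ℝ} {lam : ℝ} {v : ℝ → Fin m → ℝ} {U : ℝ → SU N}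

/-- Boundedness of `ℓ` and the discount give integrability on the whole half-line, so the cost is a
genuine integral even when the target is never met. -/
theorem integrableOn_discounted (hℓ : ContinuousOn ℓ (univ ×ˢ controlValues m)) (hlam : 0 < lam)
    (hv : v ∈ controls m) (hU : ContinuousOn U (Ici 0)) :
    IntegrableOn (fun s => ℓ (U s, v s) * Real.exp (-(lam * s))) (Ici 0) := by
  obtain ⟨M, hM, hb⟩ := exists_pos_bound hℓ
  have hexp : IntegrableOn (fun s => M * Real.exp (-(lam * s))) (Ici 0) := by
    rw [integrableOn_Ici_iff_integrableOn_Ioi]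
    simpa only [neg_mul, IntegrableOn] using (exp_neg_integrableOn_Ioi 0 hlam).const_mul M
  refine hexp.mono' ((aestronglyMeasurable_comp_control hℓ hv hU).mul
    (by fun_prop : Continuous fun s : ℝ => Real.exp (-(lam * s))).aestronglyMeasurable) ?_
  filter_upwards [ae_restrict_mem measurableSet_Ici] with s hs
  rw [norm_mul, Real.norm_of_nonneg (Real.exp_nonneg _)]
  exact mul_le_mul_of_nonneg_right (hb _ _ (hv.2 s hs)) (Real.exp_nonneg _)

theorem discounted_nonneg (hℓpos : ∀ U : SU N, ∀ v ∈ controlValues m, 0 < ℓ (U, v))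
    (hv : v ∈ controls m) {s : ℝ} (hs : 0 ≤ s) : 0 ≤ ℓ (U s, v s) * Real.exp (-(lam * s)) :=
  mul_nonneg (hℓpos _ _ (hv.2 s hs)).le (Real.exp_nonneg _)

theorem cost_nonneg (T : Set (SU N)) (hℓpos : ∀ U : SU N, ∀ v ∈ controlValues m, 0 < ℓ (U, v))
    (hv : v ∈ controls m) : 0 ≤ cost T ℓ lam v U :=
  setIntegral_nonneg (measurableSet_lt_hittingTime T U) fun _ hs =>
    discounted_nonneg hℓpos hv hs.1

theorem setIntegral_Ico_union_shift {F : ℝ → ℝ} (hF : IntegrableOn F (Ici 0)) {h : ℝ}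
    (hh : 0 ≤ h) {A : Set ℝ} (hA : MeasurableSet A) (hA0 : A ⊆ Ici 0) :
    ∫ s in Ico 0 h ∪ (fun s => s - h) ⁻¹' A, F s =
      (∫ s in Ico 0 h, F s) + ∫ s in A, F (s + h) := by
  have hAm : MeasurableSet ((fun s => s - h) ⁻¹' A) := measurable_sub_const h hA
  have hsub : (fun s => s - h) ⁻¹' A ⊆ Ici 0 := fun s hs => by
    have : 0 ≤ s - h := hA0 hs
    exact (by linarith : (0 : ℝ) ≤ s)
  rw [setIntegral_union ?_ hAm (hF.mono_set Ico_subset_Ici_self) (hF.mono_set hsub)]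
  · congr 1
    have h1 := (measurePreserving_sub_right volume h).setIntegral_preimage_emb
      (MeasurableEquiv.subRight h).measurableEmbedding (fun s => F (s + h)) A
    simpa using h1
  · refine Set.disjoint_left.2 fun s hs hs' => ?_
    have : 0 ≤ s - h := hA0 hs'
    linarith [hs.2]

/-- The cost of a control which is constant on `[0, h)`. -/
theorem cost_concat_le (T : Set (SU N))
    (hℓ : ContinuousOn ℓ (univ ×ˢ controlValues m))
    (hℓpos : ∀ U : SU N, ∀ v ∈ controlValues m, 0 < ℓ (U, v)) (hlam : 0 < lam)
    (hv : v ∈ controls m) {w : Fin m → ℝ} (hw : w ∈ controlValues m) {f : ℝ → SU N} {h : ℝ}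
    (hh : 0 < h) (hc : ContinuousOn (concat h f U) (Ici 0)) :
    cost T ℓ lam (concat h (fun _ => w) v) (concat h f U) ≤
      (∫ s in Ico 0 h, ℓ (f s, w) * Real.exp (-(lam * s))) +
        Real.exp (-(lam * h)) * cost T ℓ lam v U := by
  have hv' := concat_mem_controls hw hv h
  have hint := integrableOn_discounted hℓ hlam hv' hc
  set A := {s : ℝ | 0 ≤ s ∧ (s : EReal) < hittingTime T U} with hA
  have hAm : MeasurableSet A := measurableSet_lt_hittingTime T U
  have hA0 : A ⊆ Ici 0 := fun s hs => hs.1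
  -- Only an inclusion holds, since the first piece may meet `∂T` before time `h`; positivity of `ℓ`
  -- turns it into an inequality of costs.
  have hsub : {s : ℝ | 0 ≤ s ∧ (s : EReal) < hittingTime T (concat h f U)} ⊆
      Ico 0 h ∪ (fun s => s - h) ⁻¹' A := by
    rintro s ⟨h0, hs⟩
    rcases lt_or_ge s h with hsh | hsh
    · exact Or.inl ⟨h0, hsh⟩
    · obtain ⟨r, hr, hhit⟩ := lt_hittingTime_iff.1 hs
      refine Or.inr ⟨sub_nonneg.2 hsh, lt_hittingTime_iff.2 ⟨r - h, by linarith, fun t ht hUt => ?_⟩⟩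
      have := hhit (t + h) (by linarith) (by rwa [concat_of_le (by linarith), add_sub_cancel_right])
      linarith
  have hpos : Ico 0 h ∪ (fun s => s - h) ⁻¹' A ⊆ Ici 0 := by
    rintro s (hs | hs)
    · exact hs.1
    · have : 0 ≤ s - h := hs.1
      exact (by linarith : (0 : ℝ) ≤ s)
  have hm : MeasurableSet (Ico 0 h ∪ (fun s => s - h) ⁻¹' A) :=
    measurableSet_Ico.union (measurable_sub_const h hAm)
  calc cost T ℓ lam (concat h (fun _ => w) v) (concat h f U)
      ≤ ∫ s in Ico 0 h ∪ (fun s => s - h) ⁻¹' A,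
          ℓ (concat h f U s, concat h (fun _ => w) v s) * Real.exp (-(lam * s)) := by
        refine setIntegral_mono_set (hint.mono_set hpos) ?_ hsub.eventuallyLE
        filter_upwards [ae_restrict_mem hm] with s hs
        exact discounted_nonneg hℓpos hv' (hpos hs)
    _ = _ := by
        rw [setIntegral_Ico_union_shift hint hh.le hAm hA0]
        congr 1
        · refine setIntegral_congr_fun measurableSet_Ico fun s hs => ?_
          simp only [concat_of_lt hs.2]
        · rw [cost, ← integral_const_mul]
          refine setIntegral_congr_fun hAm fun s hs => ?_
          have hs0 : h ≤ s + h := by linarith [hs.1]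
          simp only [concat_of_le hs0, add_sub_cancel_right]
          rw [mul_add, neg_add, Real.exp_add]
          ring

/-- The cost of a trajectory which does not meet `∂T` up to time `h`. -/
theorem cost_shift_le (T : Set (SU N)) (hℓ : ContinuousOn ℓ (univ ×ˢ controlValues m))
    (hℓpos : ∀ U : SU N, ∀ v ∈ controlValues m, 0 < ℓ (U, v)) (hlam : 0 < lam)
    (hv : v ∈ controls m) (hU : ContinuousOn U (Ici 0)) {h : ℝ} (hh : 0 ≤ h)
    (hhit : ∀ t ∈ Icc 0 h, U t ∉ frontier T) :
    (∫ s in Ico 0 h, ℓ (U s, v s) * Real.exp (-(lam * s))) +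
        Real.exp (-(lam * h)) * cost T ℓ lam (fun t => v (t + h)) (fun t => U (t + h)) ≤
      cost T ℓ lam v U := by
  have hint := integrableOn_discounted hℓ hlam hv hU
  set A := {s : ℝ | 0 ≤ s ∧ (s : EReal) < hittingTime T fun t => U (t + h)} with hA
  have hAm : MeasurableSet A := measurableSet_lt_hittingTime T _
  have hsub : Ico 0 h ∪ (fun s => s - h) ⁻¹' A ⊆
      {s : ℝ | 0 ≤ s ∧ (s : EReal) < hittingTime T U} := by
    rintro s (hs | ⟨hs0, hs⟩)
    · refine ⟨hs.1, lt_hittingTime_iff.2 ⟨h, hs.2, fun t ht hUt => ?_⟩⟩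
      by_contra! hlt
      exact hhit t ⟨ht, hlt.le⟩ hUt
    · obtain ⟨r, hr, hhit'⟩ := lt_hittingTime_iff.1 hs
      refine ⟨by linarith, lt_hittingTime_iff.2 ⟨r + h, by linarith, fun t ht hUt => ?_⟩⟩
      have hth : h ≤ t := by
        by_contra! hlt
        exact hhit t ⟨ht, hlt.le⟩ hUt
      have := hhit' (t - h) (by linarith) (by simpa using hUt)
      linarith
  calc _ = ∫ s in Ico 0 h ∪ (fun s => s - h) ⁻¹' A, ℓ (U s, v s) * Real.exp (-(lam * s)) := by
        rw [setIntegral_Ico_union_shift hint hh hAm fun s hs => hs.1]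
        congr 1
        rw [cost, ← integral_const_mul]
        refine setIntegral_congr_fun hAm fun s hs => ?_
        rw [mul_add, neg_add, Real.exp_add]
        ring
    _ ≤ cost T ℓ lam v U := by
        refine setIntegral_mono_set (hint.mono_set fun s hs => hs.1) ?_ hsub.eventuallyLE
        filter_upwards [ae_restrict_mem (measurableSet_lt_hittingTime T U)] with s hs
        exact discounted_nonneg hℓpos hv hs.1

theorem bddBelow_costs (X : Fin m → su N) (T : Set (SU N))
    (hℓpos : ∀ U : SU N, ∀ v ∈ controlValues m, 0 < ℓ (U, v)) (U₀ : SU N) :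
    BddBelow {J : ℝ | ∃ v ∈ controls m, ∃ U : ℝ → SU N, IsTrajectory X v U₀ U ∧
      J = cost T ℓ lam v U} := by
  refine ⟨0, ?_⟩
  rintro J ⟨v, hv, U, -, rfl⟩
  exact cost_nonneg T hℓpos hv

theorem nonempty_costs (X : Fin m → su N) (T : Set (SU N)) (U₀ : SU N) :
    {J : ℝ | ∃ v ∈ controls m, ∃ U : ℝ → SU N, IsTrajectory X v U₀ U ∧
      J = cost T ℓ lam v U}.Nonempty := by
  refine ⟨_, _, const_mem_controls (w := 0) ?_, _, isTrajectory_const X 0 U₀, rfl⟩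
  exact ⟨fun _ => by simp, fun _ => by simp⟩

theorem valueFunction_nonneg (X : Fin m → su N) (T : Set (SU N))
    (hℓpos : ∀ U : SU N, ∀ v ∈ controlValues m, 0 < ℓ (U, v)) (U₀ : SU N) :
    0 ≤ valueFunction X T ℓ lam U₀ := by
  refine le_csInf (nonempty_costs X T U₀) ?_
  rintro J ⟨v, hv, U, -, rfl⟩
  exact cost_nonneg T hℓpos hv

theorem valueFunction_le_cost (X : Fin m → su N) (T : Set (SU N))
    (hℓpos : ∀ U : SU N, ∀ v ∈ controlValues m, 0 < ℓ (U, v)) {U₀ : SU N}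
    (hv : v ∈ controls m) (hU : IsTrajectory X v U₀ U) :
    valueFunction X T ℓ lam U₀ ≤ cost T ℓ lam v U :=
  csInf_le (bddBelow_costs X T hℓpos U₀) ⟨v, hv, U, hU, rfl⟩

/-- Dynamic programming: the value of first using a constant control. -/
theorem valueFunction_le_const_control (X : Fin m → su N) (T : Set (SU N))
    (hℓ : ContinuousOn ℓ (univ ×ˢ controlValues m))
    (hℓpos : ∀ U : SU N, ∀ v ∈ controlValues m, 0 < ℓ (U, v)) (hlam : 0 < lam) (U₀ : SU N)
    {w : Fin m → ℝ} (hw : w ∈ controlValues m) {h : ℝ} (hh : 0 < h) :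
    valueFunction X T ℓ lam U₀ ≤
      (∫ s in Ico 0 h, ℓ (expSU (s • generator X w) * U₀, w) * Real.exp (-(lam * s))) +
        Real.exp (-(lam * h)) *
          valueFunction X T ℓ lam (expSU (h • generator X w) * U₀) := by
  have hpos := Real.exp_pos (-(lam * h))
  -- The value at the new starting point is isolated so that it can be bounded below as an infimum.
  rw [← sub_le_iff_le_add', ← div_le_iff₀' hpos]
  refine le_csInf (nonempty_costs X T _) ?_
  rintro J ⟨v, hv, U, hU, rfl⟩
  have htraj := isTrajectory_concat hh hU
  rw [div_le_iff₀' hpos, sub_le_iff_le_add']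
  exact (valueFunction_le_cost X T hℓpos (concat_mem_controls hw hv h) htraj).trans
    (cost_concat_le T hℓ hℓpos hlam hv hw hh htraj.2.1)

end cost

theorem generator_single {N m : ℕ} (X : Fin m → su N) (k : Fin m) (c : ℝ) :
    generator X (Pi.single k c) = c • X k := by
  rw [generator, Finset.sum_eq_single k]
  · rw [Pi.single_eq_same]
  · intro j _ hj
    rw [Pi.single_eq_of_ne hj, zero_smul]
  · simp

theorem single_mem_controlValues {m : ℕ} (k : Fin m) {c : ℝ} (hc : |c| ≤ 1) :
    Pi.single k c ∈ controlValues m := by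
  rw [abs_le] at hc
  constructor <;> intro j <;> by_cases hj : j = k
  · subst hj; simpa using hc.1
  · simp [Pi.single_eq_of_ne hj]
  · subst hj; simpa using hc.2
  · simp [Pi.single_eq_of_ne hj]

theorem continuous_generator {N m : ℕ} (X : Fin m → su N) : Continuous (generator X) :=
  continuous_finsetSum _ fun k _ => (continuous_apply k).smul continuous_const

/-! ### Continuity of the value function and the subsolution property -/

section value

variable {N m : ℕ} {ℓ : SU N × (Fin m → ℝ) → ℝ} {lam : ℝ} {v : ℝ → Fin m → ℝ} {U : ℝ → SU N}

/-- The value function varies by at most a constant times the time needed to reach a point. -/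
theorem valueFunction_le_of_reach (X : Fin m → su N) (T : Set (SU N))
    (hℓ : ContinuousOn ℓ (univ ×ˢ controlValues m))
    (hℓpos : ∀ U : SU N, ∀ v ∈ controlValues m, 0 < ℓ (U, v)) (hlam : 0 < lam) :
    ∃ M > 0, ∀ a W, Reach X a W → ∀ U₀,
      valueFunction X T ℓ lam U₀ ≤ a * M + valueFunction X T ℓ lam (W * U₀) := by
  obtain ⟨M, hM, hb⟩ := exists_pos_bound hℓ
  refine ⟨M, hM, fun a W hW U₀ => ?_⟩
  induction hW with
  | one => simp
  | @step a W k t _ ih =>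
    suffices h : valueFunction X T ℓ lam (W * U₀) ≤
        |t| * M + valueFunction X T ℓ lam (expSU (t • X k) * (W * U₀)) by
      rw [mul_assoc]
      linarith
    rcases eq_or_ne t 0 with rfl | ht
    · simp [expSU_zero]
    have ht' : 0 < |t| := abs_pos.2 ht
    -- The factor `exp(t X_k)` is followed for time `|t|` with control `± e_k`, the sign being that
    -- of `t`.
    have hw : Pi.single k (t / |t|) ∈ controlValues m :=
      single_mem_controlValues k (by rw [abs_div, abs_abs, div_self ht'.ne'])
    have h := valueFunction_le_const_control X T hℓ hℓpos hlam (W * U₀) hw ht'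
    have hgen : |t| • generator X (Pi.single k (t / |t|)) = t • X k := by
      rw [generator_single, smul_smul, mul_div_cancel₀ _ ht'.ne']
    rw [hgen] at h
    refine h.trans (add_le_add ?_ ?_)
    · have h1 := norm_setIntegral_le_of_norm_le_const (μ := volume) (s := Ico 0 |t|) (C := M)
        (f := fun s => ℓ (expSU (s • generator X (Pi.single k (t / |t|))) * (W * U₀),
          Pi.single k (t / |t|)) * Real.exp (-(lam * s))) (by simp) fun s hs => by
          rw [norm_mul, Real.norm_of_nonneg (Real.exp_nonneg _)]
          refine (mul_le_mul (hb _ _ hw) ?_ (Real.exp_nonneg _) hM.le).trans_eq (mul_one M)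
          exact Real.exp_le_one_iff.2 (neg_nonpos.2 (mul_nonneg hlam.le hs.1))
      refine (le_abs_self _).trans (h1.trans_eq ?_)
      rw [Real.volume_real_Ico_of_le ht'.le, sub_zero, mul_comm]
    · exact mul_le_of_le_one_left (valueFunction_nonneg X T hℓpos _)
        (Real.exp_le_one_iff.2 (neg_nonpos.2 (by positivity)))

/-- `Reach` is stable under inverses with the same time, so the one-sided estimate applies from `U`
to `W` and from `W` to `U`. -/
theorem continuous_valueFunction (X : Fin m → su N)
    (hX : LieSubalgebra.lieSpan ℝ (su N) (Set.range X) = ⊤) (T : Set (SU N))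
    (hℓ : ContinuousOn ℓ (univ ×ˢ controlValues m))
    (hℓpos : ∀ U : SU N, ∀ v ∈ controlValues m, 0 < ℓ (U, v)) (hlam : 0 < lam) :
    Continuous (valueFunction X T ℓ lam) := by
  obtain ⟨M, hM, hS⟩ := valueFunction_le_of_reach X T hℓ hℓpos hlam
  refine continuous_iff_continuousAt.2 fun U => Metric.tendsto_nhds.2 fun ε hε => ?_
  have hlim : Tendsto (fun W : SU N => W * U⁻¹) (𝓝 U) (𝓝 1) := by
    have : Continuous fun W : SU N => W * U⁻¹ := continuous_id.mul continuous_const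
    simpa using this.tendsto U
  filter_upwards [hlim.eventually (eventually_reach X hX (ε := ε / (2 * M)) (by positivity))]
    with W hW
  obtain ⟨a, ha, hr⟩ := hW
  have h1 := hS _ _ hr U
  have h2 := hS _ _ hr.inv W
  rw [inv_mul_cancel_right] at h1
  rw [mul_inv_rev, inv_inv, inv_mul_cancel_right] at h2
  have haM : a * M < ε := by
    calc a * M ≤ ε / (2 * M) * M := by gcongr
      _ = ε / 2 := by field_simp
      _ < ε := half_lt_self hε
  rw [Real.dist_eq, abs_lt]
  constructor <;> linarith

theorem hasFDerivAt_differential {φ : SU N → ℝ} {Ω : Set (SU N)} (hφ : IsC1On φ Ω) {U : SU N}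
    (hU : U ∈ Ω) : HasFDerivAt (fun Y : su N => φ (expSU Y * U)) (differential φ U) 0 :=
  ((hφ U hU).differentiableAt one_ne_zero).hasFDerivAt

theorem valueFunction_subsolution_at (X : Fin m → su N) {T : Set (SU N)} (hT : IsCompact T)
    (hℓ : ContinuousOn ℓ (univ ×ˢ controlValues m))
    (hℓpos : ∀ U : SU N, ∀ v ∈ controlValues m, 0 < ℓ (U, v)) (hlam : 0 < lam)
    {φ : SU N → ℝ} (hφ : IsC1On φ Tᶜ) {U : SU N} (hU : U ∈ Tᶜ)
    (hmax : IsLocalMaxOn (fun W => valueFunction X T ℓ lam W - φ W) Tᶜ U)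
    {w : Fin m → ℝ} (hw : w ∈ controlValues m) :
    lam * valueFunction X T ℓ lam U + (-differential φ U (generator X w) - ℓ (U, w)) ≤ 0 := by
  set S := valueFunction X T ℓ lam with hS
  let γ : ℝ → SU N := fun s => expSU (s • generator X w) * U
  have hγ0 : γ 0 = U := by simp [γ, expSU_zero]
  have hγc : Continuous γ := (continuous_expSU_smul _).mul continuous_const
  have hℓγ : Continuous fun s => ℓ (γ s, w) * Real.exp (-(lam * s)) := by
    have h1 : Continuous fun s => ℓ (γ s, w) :=
      hℓ.comp_continuous (hγc.prodMk continuous_const) fun s => ⟨mem_univ _, hw⟩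
    exact h1.mul (by fun_prop)
  have hφγ : HasDerivAt (fun s => φ (γ s)) (differential φ U (generator X w)) 0 := by
    have h1 : HasDerivAt (fun s : ℝ => s • generator X w) (generator X w) 0 := 
      ((hasDerivAt_id (0 : ℝ)).smul_const (generator X w)).congr_deriv (one_smul ℝ _)
    have h2 := hasFDerivAt_differential hφ hU
    rw [← zero_smul ℝ (generator X w)] at h2
    exact h2.comp_hasDerivAt (0 : ℝ) h1
  have hexp : HasDerivAt (fun s : ℝ => Real.exp (-(lam * s))) (-lam) 0 := by
    simpa using (((hasDerivAt_id (0 : ℝ)).const_mul lam).neg).exp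
  have hint : HasDerivAt (fun h => ∫ s in (0 : ℝ)..h, ℓ (γ s, w) * Real.exp (-(lam * s)))
      (ℓ (U, w)) 0 := by
    simpa [hγ0] using (hℓγ.integral_hasStrictDerivAt 0 0).hasDerivAt
  -- The function `∫₀ʰ ℓ e^{-λs} ds + e^{-λh} (S U + φ(γ h) - φ U) - S U` vanishes at `h = 0` and is
  -- nonnegative for small `h > 0`, by dynamic programming and the local maximum. Its derivative at
  -- `0`, which is `ℓ(U, w) - λ S U + Dφ(U)·w`, is thus nonnegative.
  have hg := (hint.add (hexp.mul ((hφγ.sub_const (φ U)).const_add (S U)))).sub_const (S U)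
  have hlim := (hasDerivAt_iff_tendsto_slope.1 hg).mono_left
    (nhdsWithin_mono (s := Ioi 0) (0 : ℝ) fun s (hs : 0 < s) => hs.ne')
  have hmax' : ∀ᶠ s in 𝓝 (0 : ℝ), S (γ s) - φ (γ s) ≤ S U - φ U := by
    have h1 : ∀ᶠ W in 𝓝 U, S W - φ W ≤ S U - φ U := by
      have h2 := hmax
      rwa [IsLocalMaxOn, IsMaxFilter, hT.isClosed.isOpen_compl.nhdsWithin_eq hU] at h2
    have h3 := hγc.tendsto 0
    rw [hγ0] at h3
    exact h3.eventually h1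
  have hnonneg := ge_of_tendsto hlim (b := 0) <| by
    filter_upwards [self_mem_nhdsWithin, hmax'.filter_mono nhdsWithin_le_nhds] with h hh hle
    have hh0 : 0 < h := hh
    have hdp := valueFunction_le_const_control X T hℓ hℓpos hlam U hw hh0
    rw [integral_Ico_eq_integral_Ioc, ← intervalIntegral.integral_of_le hh0.le] at hdp
    rw [slope_def_field]
    refine div_nonneg ?_ (by simpa using hh0.le)
    have hmul : Real.exp (-(lam * h)) * S (γ h) ≤
        Real.exp (-(lam * h)) * (S U + (φ (γ h) - φ U)) :=
      mul_le_mul_of_nonneg_left (by linarith) (Real.exp_nonneg _)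
    simp only [Pi.add_apply, Pi.mul_apply, intervalIntegral.integral_same, hγ0, sub_self, add_zero,
      mul_zero, neg_zero, Real.exp_zero, one_mul, zero_add, sub_zero]
    change S U ≤ _ + Real.exp (-(lam * h)) * S (γ h) at hdp
    linarith
  simp only [hγ0, sub_self, add_zero, mul_zero, neg_zero, Real.exp_zero, one_mul] at hnonneg
  linarith

/-- The chain rule through `log`, whose derivative at `1` is the identity, lets the matrix increment
`W - 1` replace the exponential coordinate. This increment is linear in the trajectory, so it can be
integrated directly. -/
theorem eventually_abs_sub_differential_le {φ : SU N → ℝ} {Ω : Set (SU N)} (hφ : IsC1On φ Ω)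
    {U : SU N} (hU : U ∈ Ω) {P : Matrix (Fin N) (Fin N) ℂ →L[ℝ] su N}
    (hP : ∀ Y : su N, P Y = Y) {η : ℝ} (hη : 0 < η) :
    ∀ᶠ W : SU N in 𝓝 1, |φ (W * U) - φ U - differential φ U (P ((W : Matrix _ _ ℂ) - 1))| ≤
      η * ‖(W : Matrix (Fin N) (Fin N) ℂ) - 1‖ := by
  have h1 := (P.hasFDerivAt (x := matrixLog N 1)).comp (1 : Matrix (Fin N) (Fin N) ℂ)
    (hasStrictFDerivAt_matrixLog N).hasFDerivAt
  have hP0 : (P ∘ matrixLog N) 1 = 0 := by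
    rw [Function.comp_apply, matrixLog_one]
    exact map_zero P
  have h2 := hasFDerivAt_differential hφ hU
  rw [← hP0] at h2
  have h3 := (HasFDerivAt.comp (1 : Matrix (Fin N) (Fin N) ℂ) h2 h1).isLittleO.def hη
  have hcoe : Tendsto (fun W : SU N => (W : Matrix (Fin N) (Fin N) ℂ)) (𝓝 1) (𝓝 1) :=
    continuous_subtype_val.tendsto (1 : SU N)
  filter_upwards [hcoe.eventually h3, eventually_matrixLog_mem_su N,
    hcoe.eventually (eventually_exp_matrixLog N)] with W hW hlog hexp
  have hPW : expSU (P (matrixLog N W)) = W := by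
    have := hP ⟨_, hlog⟩
    refine Subtype.ext ?_
    rw [show P (matrixLog N W) = ⟨_, hlog⟩ from this]
    exact hexp
  simp only [Function.comp_apply] at hW
  rw [hPW] at hW
  have hP1 : P (matrixLog N 1) = 0 := hP0
  rw [hP1, expSU_zero, one_mul] at hW
  exact hW

end value

/-! ### The supersolution property -/

section supersolution

variable {N m : ℕ} {X : Fin m → su N} {v : ℝ → Fin m → ℝ} {U : ℝ → SU N} {U₀ : SU N}

theorem continuous_generator_mul (X : Fin m → su N) :
    Continuous fun p : SU N × (Fin m → ℝ) =>
      (generator X p.2 : Matrix (Fin N) (Fin N) ℂ) * (p.1 : Matrix (Fin N) (Fin N) ℂ) :=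
  (continuous_subtype_val.comp ((continuous_generator X).comp continuous_snd)).mul
    (continuous_subtype_val.comp continuous_fst)

/-- The fundamental theorem of calculus tolerates the countably many times at which the control is
discontinuous. -/
theorem integral_trajectory {E : Type*} [NormedAddCommGroup E] [NormedSpace ℝ E] [CompleteSpace E]
    (D : Matrix (Fin N) (Fin N) ℂ →L[ℝ] E) (hv : v ∈ controls m) (hU : IsTrajectory X v U₀ U)
    {t : ℝ} (ht : 0 ≤ t) :
    IntervalIntegrable (fun s => D ((generator X (v s) : Matrix (Fin N) (Fin N) ℂ) * U s))
      volume 0 t ∧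
    ∫ s in (0 : ℝ)..t, D ((generator X (v s) : Matrix (Fin N) (Fin N) ℂ) * U s) =
      D (U t) - D U₀ := by
  obtain ⟨hU0, hUc, hUd⟩ := hU
  have hF : ContinuousOn (fun p : SU N × (Fin m → ℝ) =>
      D ((generator X p.2 : Matrix (Fin N) (Fin N) ℂ) * (p.1 : Matrix (Fin N) (Fin N) ℂ)))
      (univ ×ˢ controlValues m) :=
    (D.continuous.comp (continuous_generator_mul X)).continuousOn
  have hint : IntervalIntegrable
      (fun s => D ((generator X (v s) : Matrix (Fin N) (Fin N) ℂ) * U s)) volume 0 t := by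
    obtain ⟨M, hM, hb⟩ := exists_pos_bound hF
    rw [intervalIntegrable_iff_integrableOn_Ioc_of_le ht]
    have hsub : Ioc 0 t ⊆ Ici (0 : ℝ) := fun s hs => hs.1.le
    refine Integrable.mono' (g := fun _ => M) (by simp)
      ((aestronglyMeasurable_comp_control hF hv hUc).mono_set hsub) ?_
    filter_upwards [ae_restrict_mem measurableSet_Ioc] with s hs
    exact hb _ _ (hv.2 s hs.1.le)
  refine ⟨hint, ?_⟩
  have h := integral_eq_of_hasDerivAt_off_countable_of_le
    (fun s => D (U s)) (fun s => D ((generator X (v s) : Matrix (Fin N) (Fin N) ℂ) * U s)) ht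
    (countable_not_continuousWithinAt hv)
    (D.continuous.comp_continuousOn (continuous_subtype_val.comp_continuousOn
      (hUc.mono fun s hs => hs.1))) (fun s hs => ?_) hint
  · rw [h, hU0]
  · have hc : ContinuousWithinAt v (Ici 0) s := by
      by_contra hc
      exact hs.2 ⟨hs.1.1.le, hc⟩
    exact D.hasFDerivAt.comp_hasDerivAt s
      ((hUd s hs.1.1.le hc).hasDerivAt (Ici_mem_nhds hs.1.1))

/-- Trajectories are Lipschitz, with a constant independent of the control. -/
theorem exists_lipschitz_trajectory (X : Fin m → su N) {E : Type*} [NormedAddCommGroup E]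
    [NormedSpace ℝ E] [CompleteSpace E] (D : Matrix (Fin N) (Fin N) ℂ →L[ℝ] E) :
    ∃ C > 0, ∀ v ∈ controls m, ∀ U₀, ∀ U : ℝ → SU N, IsTrajectory X v U₀ U → ∀ t, 0 ≤ t →
      ‖D (U t) - D U₀‖ ≤ C * t := by
  obtain ⟨C, hC, hb⟩ := exists_pos_bound (m := m) (F := fun p : SU N × (Fin m → ℝ) =>
      D ((generator X p.2 : Matrix (Fin N) (Fin N) ℂ) * (p.1 : Matrix (Fin N) (Fin N) ℂ)))
      (D.continuous.comp (continuous_generator_mul X)).continuousOn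
  refine ⟨C, hC, fun v hv U₀ U hU t ht => ?_⟩
  rw [← (integral_trajectory D hv hU ht).2]
  have h := intervalIntegral.norm_integral_le_of_norm_le_const (a := 0) (b := t) (C := C)
    (f := fun s => D ((generator X (v s) : Matrix (Fin N) (Fin N) ℂ) * U s)) fun s hs => by
      rw [uIoc_of_le ht] at hs
      exact hb _ _ (hv.2 s hs.1.le)
  rwa [sub_zero, abs_of_nonneg ht] at h

/-- Compactness of the control set bounds the values from above; without a bound the real supremum
would default to `0`. -/
theorem le_hamiltonian {ℓ : SU N × (Fin m → ℝ) → ℝ} (X : Fin m → su N)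
    (hℓ : ContinuousOn ℓ (univ ×ˢ controlValues m)) (U : SU N) (ζ : su N →L[ℝ] ℝ)
    {w : Fin m → ℝ} (hw : w ∈ controlValues m) :
    -ζ (generator X w) - ℓ (U, w) ≤ hamiltonian X ℓ U ζ := by
  refine le_csSup ?_ ⟨w, hw, rfl⟩
  have hc : ContinuousOn (fun w => -ζ (generator X w) - ℓ (U, w)) (controlValues m) :=
    (ζ.continuous.comp (continuous_generator X)).neg.continuousOn.sub
      (hℓ.comp (continuous_const.prodMk continuous_id).continuousOn fun w hw => ⟨mem_univ _, hw⟩)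
  refine ((isCompact_controlValues m).bddAbove_image hc).mono ?_
  rintro _ ⟨w, hw, rfl⟩
  exact ⟨w, hw, rfl⟩

/-- The running cost plus the rate of change of a test function is bounded below by the
Hamiltonian, up to a small error, near the initial state and time, uniformly in the control. -/
theorem eventually_hamiltonian_le {ℓ : SU N × (Fin m → ℝ) → ℝ} (X : Fin m → su N)
    (hℓ : ContinuousOn ℓ (univ ×ˢ controlValues m)) (lam : ℝ) (U : SU N) (ζ : su N →L[ℝ] ℝ)
    {D : Matrix (Fin N) (Fin N) ℂ →L[ℝ] ℝ}
    (hD : ∀ Y : su N, D ((Y : Matrix (Fin N) (Fin N) ℂ) * U) = ζ Y) {η : ℝ} (hη : 0 < η) :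
    ∀ᶠ p : SU N × ℝ in 𝓝 (U, 0), ∀ w ∈ controlValues m,
      -hamiltonian X ℓ U ζ - η ≤ ℓ (p.1, w) * Real.exp (-(lam * p.2)) +
        D ((generator X w : Matrix (Fin N) (Fin N) ℂ) * p.1) := by
  have : CompactSpace (controlValues m) := isCompact_iff_compactSpace.1 (isCompact_controlValues m)
  have hℓc : Continuous fun q : (SU N × ℝ) × controlValues m => ℓ (q.1.1, q.2) :=
    hℓ.comp_continuous (by fun_prop) fun q => ⟨mem_univ _, q.2.2⟩
  obtain ⟨K, hK⟩ : ∃ K : (SU N × ℝ) × controlValues m → ℝ, ∀ q, K q =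
      ℓ (q.1.1, q.2) * Real.exp (-(lam * q.1.2)) +
        D ((generator X q.2 : Matrix (Fin N) (Fin N) ℂ) * q.1.1) := ⟨_, fun _ => rfl⟩
  have hc : Continuous K := by
    rw [funext hK]
    have h1 : Continuous fun q : (SU N × ℝ) × controlValues m => Real.exp (-(lam * q.1.2)) := by
      fun_prop
    have h2 : Continuous fun q : (SU N × ℝ) × controlValues m =>
        (q.1.1, (q.2 : Fin m → ℝ)) := by fun_prop
    have h3 := D.continuous.comp ((continuous_generator_mul X).comp h2)
    exact (hℓc.mul h1).add h3
  have hlt : ∀ w : controlValues m, -hamiltonian X ℓ U ζ - η < K ((U, 0), w) := fun w => by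
    have h1 : K ((U, 0), w) = ℓ (U, w) * Real.exp (-(lam * 0)) + ζ (generator X w) :=
      (hK _).trans (congrArg _ (hD (generator X w)))
    rw [h1, mul_zero, neg_zero, Real.exp_zero, mul_one]
    linarith [le_hamiltonian X hℓ U ζ w.2]
  -- The strict inequality at `(U, 0)` holds for each control value; compactness yields one
  -- neighbourhood valid for all of them.
  have h := (isCompact_univ (X := controlValues m)).eventually_forall_of_forall_eventually
    (x₀ := (U, (0 : ℝ))) (P := fun p w => -hamiltonian X ℓ U ζ - η < K (p, w))
    fun w _ => (hc.tendsto ((U, (0 : ℝ)), w)).eventually (lt_mem_nhds (hlt w))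
  filter_upwards [h] with p hp w hw
  have := hp ⟨w, hw⟩ (mem_univ _)
  rw [hK] at this
  exact this.le

/-- This provides a restart time for a near-optimal trajectory, as `isTrajectory_shift` needs. -/
theorem exists_continuity_point (hv : v ∈ controls m) {a b : ℝ} (ha : 0 ≤ a) (hab : a < b) :
    ∃ h ∈ Ioo a b, ContinuousWithinAt v (Ici 0) h := by
  by_contra! hn
  refine (Ioo_infinite hab) ((hv.1.1 b).subset fun h hh => ?_)
  exact ⟨⟨ha.trans hh.1.le, hh.2.le⟩, hn h hh⟩

set_option maxHeartbeats 800000 in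
-- By contradiction: if `F < 0`, then up to a short time `h` every control would cost more than `S
-- U₀` by an amount of order `h`, whereas some control exceeds it by less than `h²`.
theorem valueFunction_supersolution_at {ℓ : SU N × (Fin m → ℝ) → ℝ} {lam : ℝ} (X : Fin m → su N)
    {T : Set (SU N)} (hT : IsCompact T) (hℓ : ContinuousOn ℓ (univ ×ˢ controlValues m))
    (hℓpos : ∀ U : SU N, ∀ v ∈ controlValues m, 0 < ℓ (U, v)) (hlam : 0 < lam)
    {φ : SU N → ℝ} (hφ : IsC1On φ Tᶜ) {U₀ : SU N} (hU₀ : U₀ ∈ Tᶜ)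
    (hmin : IsLocalMinOn (fun W => valueFunction X T ℓ lam W - φ W) Tᶜ U₀) :
    0 ≤ lam * valueFunction X T ℓ lam U₀ + hamiltonian X ℓ U₀ (differential φ U₀) := by
  set S := valueFunction X T ℓ lam with hS
  set ζ := differential φ U₀ with hζ
  obtain ⟨P, hP⟩ := exists_projection_su N
  let R : Matrix (Fin N) (Fin N) ℂ →L[ℝ] Matrix (Fin N) (Fin N) ℂ :=
    mulLeftRight 1 ((U₀⁻¹ : SU N) : Matrix (Fin N) (Fin N) ℂ)
  have hR : ∀ W : SU N, R W = ((W * U₀⁻¹ : SU N) : Matrix (Fin N) (Fin N) ℂ) := fun W => by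
    rw [SU.coe_mul]
    exact (mulLeftRight_apply _ _ _).trans (by rw [one_mul])
  have hR₀ : R U₀ = 1 := by rw [hR, mul_inv_cancel]; rfl
  let D : Matrix (Fin N) (Fin N) ℂ →L[ℝ] ℝ := ζ.comp (P.comp R)
  have hD : ∀ Y : su N, D ((Y : Matrix (Fin N) (Fin N) ℂ) * U₀) = ζ Y := by
    intro Y
    have h1 : R ((Y : Matrix (Fin N) (Fin N) ℂ) * U₀) = Y := by
      refine (mulLeftRight_apply _ _ _).trans ?_
      rw [one_mul, mul_assoc, ← SU.coe_mul, mul_inv_cancel]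
      exact mul_one _
    change ζ (P (R _)) = ζ Y
    rw [h1, hP]
  obtain ⟨C, hC, hUC⟩ := exists_lipschitz_trajectory X
    (ContinuousLinearMap.id ℝ (Matrix (Fin N) (Fin N) ℂ))
  obtain ⟨CR, hCR, hURC⟩ := exists_lipschitz_trajectory X R
  obtain ⟨CD, hCD, hUDC⟩ := exists_lipschitz_trajectory X D
  by_contra! hneg
  -- The deficit is split into `η` for the Hamiltonian estimate, `CR η` for the expansion of `φ`,
  -- `η` for the terms quadratic in `h`, and a spare `η` for the contradiction.
  set η := -(lam * S U₀ + hamiltonian X ℓ U₀ ζ) / (3 + CR) with hη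
  have hη0 : 0 < η := div_pos (neg_pos.2 hneg) (by positivity)
  have hlim : Tendsto (fun W : SU N => W * U₀⁻¹) (𝓝 U₀) (𝓝 1) := by
    have : Continuous fun W : SU N => W * U₀⁻¹ := continuous_id.mul continuous_const
    simpa using this.tendsto U₀
  have hmin' : ∀ᶠ W in 𝓝 U₀, S U₀ - φ U₀ ≤ S W - φ W := by
    have h2 := hmin
    rwa [IsLocalMinOn, IsMinFilter, hT.isClosed.isOpen_compl.nhdsWithin_eq hU₀] at h2
  have hstate := (hmin'.and ((hlim.eventually
    (eventually_abs_sub_differential_le hφ hU₀ hP hη0)).and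
      (hT.isClosed.isOpen_compl.mem_nhds hU₀))).prod_inl_nhds (0 : ℝ)
  obtain ⟨ε, hε, hball⟩ := Metric.eventually_nhds_iff.1
    (hstate.and (eventually_hamiltonian_le X hℓ lam U₀ ζ hD hη0))
  -- The first bound keeps every trajectory in the good neighbourhood; the second makes `(λ CD + 1)
  -- h² ≤ h η`.
  set δ := min (ε / (2 * (C + 1))) (η / (lam * CD + 1)) with hδ
  have hδ0 : 0 < δ := by positivity
  have hnear : ∀ v ∈ controls m, ∀ U : ℝ → SU N, IsTrajectory X v U₀ U → ∀ t ∈ Icc 0 δ,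
      dist (U t, t) (U₀, (0 : ℝ)) < ε := by
    intro v hv U hU t ht
    have h1 : dist (U t) U₀ ≤ C * t := by
      rw [Subtype.dist_eq, dist_eq_norm]
      exact hUC v hv U₀ U hU t ht.1
    have h2 : (C + 1) * t < ε := by
      calc (C + 1) * t ≤ (C + 1) * (ε / (2 * (C + 1))) := by
            gcongr
            exact ht.2.trans (min_le_left _ _)
        _ = ε / 2 := by field_simp
        _ < ε := half_lt_self hε
    have hCt : 0 ≤ C * t := mul_nonneg hC.le ht.1
    rw [Prod.dist_eq, max_lt_iff, Real.dist_eq, sub_zero, abs_of_nonneg ht.1]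
    constructor <;> nlinarith [ht.1]
  -- The control must be chosen before `h`, which depends on it. With `h > δ / 2`, the tolerance `δ²
  -- / 4` is still at most `h²`.
  obtain ⟨J, ⟨v, hv, U, hU, rfl⟩, hJ⟩ := exists_lt_of_csInf_lt
    (nonempty_costs (lam := lam) (ℓ := ℓ) X T U₀)
    (lt_add_of_pos_right (S U₀) (by positivity : 0 < δ ^ 2 / 4))
  obtain ⟨h, ⟨hδh, hhδ⟩, hvh⟩ := exists_continuity_point hv (half_pos hδ0).le (half_lt_self hδ0)
  have hh : 0 < h := (half_pos hδ0).trans hδh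
  have hgood : ∀ t ∈ Icc 0 h, _ := fun t ht =>
    hball (hnear v hv U hU t ⟨ht.1, ht.2.trans hhδ.le⟩)
  have hshift := (add_le_add_right (mul_le_mul_of_nonneg_left
    (valueFunction_le_cost X T hℓpos (shift_mem_controls hv hh.le) (isTrajectory_shift hU hh hvh))
    (Real.exp_nonneg (-(lam * h)))) _).trans (cost_shift_le T hℓ hℓpos hlam hv hU.2.1 hh.le
      fun t ht hfr => (hgood t ht).1.2.2 (hT.isClosed.frontier_subset hfr))
  rw [integral_Ico_eq_integral_Ioc, ← intervalIntegral.integral_of_le hh.le] at hshift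
  obtain ⟨⟨hSφ, hexpand, -⟩, -⟩ := hgood h (right_mem_Icc.2 hh.le)
  simp only at hSφ hexpand
  rw [inv_mul_cancel_right, ← hR, ← hR₀] at hexpand
  have hΔ : ζ (P (R (U h) - R U₀)) = D (U h) - D U₀ := by
    rw [map_sub, map_sub]; rfl
  rw [hΔ] at hexpand
  have hexpand' := (abs_le.1 (hexpand.trans
    (mul_le_mul_of_nonneg_left (hURC v hv U₀ U hU h hh.le) hη0.le))).1
  have hΔC := abs_le.1 (hUDC v hv U₀ U hU h hh.le)
  obtain ⟨hDint, hDeq⟩ := integral_trajectory D hv hU hh.le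
  have hcint : IntervalIntegrable (fun s => ℓ (U s, v s) * Real.exp (-(lam * s))) volume 0 h := by
    rw [intervalIntegrable_iff_integrableOn_Ioc_of_le hh.le]
    exact (integrableOn_discounted hℓ hlam hv hU.2.1).mono_set fun s hs => hs.1.le
  have hlow : h * (-hamiltonian X ℓ U₀ ζ - η) ≤
      (∫ s in (0 : ℝ)..h, ℓ (U s, v s) * Real.exp (-(lam * s))) + (D (U h) - D U₀) := by
    rw [← hDeq, ← intervalIntegral.integral_add hcint hDint]
    have h1 := intervalIntegral.integral_mono_on (μ := volume) hh.le
      (intervalIntegrable_const (c := -hamiltonian X ℓ U₀ ζ - η)) (hcint.add hDint)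
      fun s hs => (hgood s hs).2 (v s) (hv.2 s hs.1)
    rwa [intervalIntegral.integral_const, sub_zero, smul_eq_mul] at h1
  have he1 : Real.exp (-(lam * h)) ≤ 1 := Real.exp_le_one_iff.2 (neg_nonpos.2 (by positivity))
  have he2 : 1 - lam * h ≤ Real.exp (-(lam * h)) := by linarith [Real.add_one_le_exp (-(lam * h))]
  have hS0 : 0 ≤ S U₀ := valueFunction_nonneg X T hℓpos U₀
  set e := Real.exp (-(lam * h)) with he
  set Δ := D (U h) - D U₀ with hΔdef
  set I := ∫ s in (0 : ℝ)..h, ℓ (U s, v s) * Real.exp (-(lam * s)) with hI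
  have hSh : S U₀ + Δ - η * (CR * h) ≤ S (U h) := by linarith
  have he0 : 0 ≤ e := Real.exp_nonneg _
  have b0 : e * (S U₀ + Δ - η * (CR * h)) ≤ e * S (U h) := mul_le_mul_of_nonneg_left hSh he0
  have b1 : (1 - e) * S U₀ ≤ lam * h * S U₀ := mul_le_mul_of_nonneg_right (by linarith) hS0
  have b2 : (1 - e) * Δ ≤ lam * h * (CD * h) :=
    (mul_le_mul_of_nonneg_left hΔC.2 (by linarith)).trans
      (mul_le_mul_of_nonneg_right (by linarith) (by positivity))
  have b3 : e * (η * (CR * h)) ≤ η * (CR * h) := mul_le_of_le_one_left (by positivity) he1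
  have b4 : δ ^ 2 / 4 ≤ h * h := by nlinarith
  have b5 : (lam * CD + 1) * h ≤ η := by
    have : δ ≤ η / (lam * CD + 1) := min_le_right _ _
    rw [le_div_iff₀ (by positivity)] at this
    nlinarith [mul_pos hlam hCD]
  have b6 : h * ((lam * CD + 1) * h) ≤ h * η := mul_le_mul_of_nonneg_left b5 hh.le
  have hηeq : η * (3 + CR) = -(lam * S U₀ + hamiltonian X ℓ U₀ ζ) := by
    rw [hη]; field_simp
  have b7 : h * (η * (3 + CR)) = h * -(lam * S U₀ + hamiltonian X ℓ U₀ ζ) := by rw [hηeq]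
  have b8 : 0 < h * η := mul_pos hh hη0
  -- Together these bounds give `2 h η < (λ CD + 1) h² ≤ h η`, which is absurd.
  nlinarith

end supersolution

end SpinControl

theorem mainTheorem5 (n m : ℕ) (X : Fin m → SpinControl.su (2 ^ n))
    (hX : LieSubalgebra.lieSpan ℝ (SpinControl.su (2 ^ n)) (Set.range X) = ⊤)
    (T : Set (SpinControl.SU (2 ^ n))) (hT : IsCompact T)
    (ℓ : SpinControl.SU (2 ^ n) × (Fin m → ℝ) → ℝ)
    (hℓ : ContinuousOn ℓ (Set.univ ×ˢ SpinControl.controlValues m))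
    (hℓpos : ∀ U : SpinControl.SU (2 ^ n), ∀ v ∈ SpinControl.controlValues m, 0 < ℓ (U, v))
    (lam : ℝ) (hlam : 0 < lam) :
    SpinControl.IsContinuousViscositySolution Tᶜ
      (fun U r ζ => lam * r + SpinControl.hamiltonian X ℓ U ζ)
      (SpinControl.valueFunction X T ℓ lam) := by
  have hc := (SpinControl.continuous_valueFunction X hX T hℓ hℓpos hlam).continuousOn
    (s := closure Tᶜ)
  refine ⟨⟨hc, fun φ hφ U hU hmax => ?_⟩, hc, fun φ hφ U hU hmin =>
    SpinControl.valueFunction_supersolution_at X hT hℓ hℓpos hlam hφ hU hmin⟩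
  rw [← le_neg_iff_add_nonpos_left]
  -- The zero control shows that the set under the supremum is nonempty.
  refine csSup_le ⟨_, 0, ⟨fun _ => by simp, fun _ => by simp⟩, rfl⟩ ?_
  rintro _ ⟨w, hw, rfl⟩
  have := SpinControl.valueFunction_subsolution_at X hT hℓ hℓpos hlam hφ hU hmax hw
  linarith
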